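/- **Setting.** Let $\mathcal X$ be a metric space with its Borel $\sigma$-algebra, and let $\rho$ be a probability measure on $\mathcal X\times\mathbb R$ with marginal $\rho_X$ on $\mathcal X$. Write $(X,Y)\sim\rho$ and $Y=f^*(X)+\epsilon$, where $\epsilon$ is integrable and $\mathbf E(\epsilon\mid X)=0$. For measurable $f:\mathcal X\to\mathbb R$ let $p_E$ be the density of $E(f)=Y-f(X)$, let $\mathscr R(f)=-\log\int_{\mathbb R}p_E(e)^2\,de$, and let $\mathscr R^*=\inf_f\mathscr R(f)$ over all measurable $f$. Assume that the model is *MEE admissible*: the conditional density $p_{\epsilon|X}(\cdot\mid x)$ of $\epsilon$ given $X=x$ exists and is bounded uniformly in $x$; $f^*$ is measurable and bounded; and $\mathscr R$ has a measurable minimizer. Assume that the model is *homoskedastic*: $\epsilon$ is independent of $X$. A set $\mathcal H$ of continuous functions on $\mathcal X$ is *MEE admissible* if it is uniformly bounded; if it contains $f^*$ and a minimizer of $\mathscr R$; and if there are $c>0$ and $0<s<2$ with $\log\mathcal N_2(\mathcal H,\varepsilon)\le c\,\varepsilon^{-s}$ for all $\varepsilon>0$. Here $\mathcal N_2(\mathcal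 H,\varepsilon)$ is the supremum, over $n\ge1$ and $x\in\mathcal X^n$, of the minimal number of balls in $\mathbb R^n$ of radius $\varepsilon$ for the metric $d_2(a,b)=(\frac1n\sum_i|a_i-b_i|^2)^{1/2}$ that cover $\{(f(x_i))_{i=1}^n:f\in\mathcal H\}$. For an i.i.d. sample $\mathbf z=\{(x_i,y_i)\}_{i=1}^n$ from $\rho$ and a bandwidth $h=h(n)>0$, let $f_{\mathbf z}$ be any (not necessarily measurably chosen) minimizer over $f\in\mathcal H$ of $$\mathscr R_{\mathbf z}(f)=-\log\Big(\frac1{n^2}\sum_{i,j=1}^n G_h(e_i-e_j)\Big),\qquad e_i=y_i-f(x_i),\quad G_h(t)=\frac1{\sqrt{2\pi}\,h}e^{-t^2/(2h^2)}.$$ Probabilities of possibly non-measurable events are outer probabilities, and $\mathbf E(f^*-f)=\int(f^*-f)\,d\rho_X$. **Theorem.** 1. $\mathscr R^*=\mathscr R(f^*)$, and for every constant $b$ the function $f^*+b$ is a minimizer of $\mathscr R$. 2. For every $M$ there is a constant $C>0$, depending only on $\rho$ and $M$, such that for every measurable $f$ with $|f|\le M$ on $\mathcal X$, $$\|f+\mathbf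 E(f^*-f)-f^*\|^2_{L^2_{\rho_X}}\le C\,(\mathscr R(f)-\mathscr R^*).$$ Suppose in addition that $\mathcal X$ is separable and that $\mathcal H$ is MEE admissible. 3. If $h(n)\to0$ and $h(n)^2\sqrt n\to\infty$, then $f_{\mathbf z}+\mathbf E(f^*-f_{\mathbf z})\to f^*$ in probability: for every $\varepsilon>0$, $\mathbf P\big(\|f_{\mathbf z}+\mathbf E(f^*-f_{\mathbf z})-f^*\|^2_{L^2_{\rho_X}}>\varepsilon\big)\to0$ as $n\to\infty$. 4. Suppose further that $p_{\epsilon|X}(\cdot\mid x)$ is differentiable with derivative bounded by a constant $M'$ independent of $x$, and let $0<c_1\le c_2$. Then there is a constant $C>0$, independent of $n$, $\delta$, $h$ and the choice of $f_{\mathbf z}$, such that whenever $c_1n^{-1/6}\le h(n)\le c_2n^{-1/6}$ for all $n\ge1$, then for all $0<\delta<1$ and all $n\ge1$, with probability at least $1-\delta$, $$\|f_{\mathbf z}+\mathbf E(f^*-f_{\mathbf z})-f^*\|^2_{L^2_{\rho_X}}\le C\sqrt{\log(2/\delta)}\;n^{-1/6}.$$ -/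

import Mathlib

open MeasureTheory ProbabilityTheory Filter Topology

noncomputable section

namespace MEE

/-! The regression model is the law `ρ` of `(X, Y)` on `𝒳 × ℝ` (a response space `𝒴 ⊆ ℝ` is the case
where `ρ` is concentrated on `𝒳 × 𝒴`); the marginal law of `X` is `ρ.fst`. -/

section Model

variable {𝒳 : Type*} [MeasurableSpace 𝒳]

/-- The error variable `E(f) = Y - f(X)`. For `f = f*` it is the noise `ε`. -/
def errorVar (f : 𝒳 → ℝ) (z : 𝒳 × ℝ) : ℝ := z.2 - f z.1

/-- The probability density function of the error variable `E(f)`. -/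
def errorDensity (ρ : Measure (𝒳 × ℝ)) (f : 𝒳 → ℝ) (e : ℝ) : ℝ :=
  (pdf (errorVar f) ρ volume e).toReal

/-- Rényi's entropy of order two of the error variable: `-log ∫ p_E(e)² de`. -/
def errorEntropy (ρ : Measure (𝒳 × ℝ)) (f : 𝒳 → ℝ) : ℝ :=
  -Real.log (∫ e : ℝ, errorDensity ρ f e ^ 2)

/-- The infimum of the error entropy over all measurable functions. -/
def minEntropy (ρ : Measure (𝒳 × ℝ)) : ℝ :=
  ⨅ f : {f : 𝒳 → ℝ // Measurable f}, errorEntropy ρ f.1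

/-- `f` is a measurable minimizer of the error entropy among all measurable functions. -/
def IsEntropyMinimizer (ρ : Measure (𝒳 × ℝ)) (f : 𝒳 → ℝ) : Prop :=
  Measurable f ∧ ∀ g : 𝒳 → ℝ, Measurable g → errorEntropy ρ f ≤ errorEntropy ρ g

/-- The model `Y = f*(X) + ε`, `E(ε | X) = 0`. -/
structure IsRegressionModel (ρ : Measure (𝒳 × ℝ)) (fstar : 𝒳 → ℝ) : Prop where
  measurable : Measurable fstar
  integrable_noise : Integrable (errorVar fstar) ρ
  condExp_noise :
    ρ[errorVar fstar | MeasurableSpace.comap (Prod.fst : 𝒳 × ℝ → 𝒳) inferInstance] =ᵐ[ρ] 0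

/-- `p x` is, for almost every `x`, a density of the conditional law of the noise
given `X = x`. -/
structure IsNoiseDensity (ρ : Measure (𝒳 × ℝ)) [IsProbabilityMeasure ρ] (fstar : 𝒳 → ℝ)
    (p : 𝒳 → ℝ → ℝ) : Prop where
  measurable : Measurable (Function.uncurry p)
  nonneg : ∀ x t, 0 ≤ p x t
  condLaw : ∀ᵐ x ∂ρ.fst,
    condDistrib (errorVar fstar) Prod.fst ρ x =
      (volume : Measure ℝ).withDensity (fun t => ENNReal.ofReal (p x t))

/-- MEE admissible regression models. -/
structure AdmissibleModel (ρ : Measure (𝒳 × ℝ)) [IsProbabilityMeasure ρ] (fstar : 𝒳 → ℝ) :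
    Prop where
  model : IsRegressionModel ρ fstar
  exists_density : ∃ (Mp : ℝ) (p : 𝒳 → ℝ → ℝ), IsNoiseDensity ρ fstar p ∧ ∀ x t, p x t ≤ Mp
  bounded : ∃ M : ℝ, 0 < M ∧ ∀ x, |fstar x| ≤ M
  exists_minimizer : ∃ f : 𝒳 → ℝ, IsEntropyMinimizer ρ f

/-- The noise is independent of `X`. -/
def Homoskedastic (ρ : Measure (𝒳 × ℝ)) (fstar : 𝒳 → ℝ) : Prop :=
  IndepFun (Prod.fst : 𝒳 × ℝ → 𝒳) (errorVar fstar) ρ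

/-- `‖f + E(f* - f) - f*‖²` in `L²(ρ_X)`. -/
def adjustedSqDist (ρ : Measure (𝒳 × ℝ)) (fstar f : 𝒳 → ℝ) : ℝ :=
  ∫ x, (f x + (∫ u, (fstar u - f u) ∂ρ.fst) - fstar x) ^ 2 ∂ρ.fst

end Model

section Covering

/-- The normalized `ℓ²` distance on `ℝⁿ`. -/
def d2 {n : ℕ} (a b : Fin n → ℝ) : ℝ :=
  Real.sqrt ((1 / (n : ℝ)) * ∑ i, |a i - b i| ^ 2)

/-- The minimal number of `d`-balls of radius `ε` whose union covers `S` (`⊤` if there is no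
finite cover). -/
def coveringNumber {α : Type*} (d : α → α → ℝ) (S : Set α) (ε : ℝ) : ℕ∞ :=
  ⨅ (t : Set α) (_ : S ⊆ ⋃ a ∈ t, {b | d b a < ε}), t.encard

/-- The `ℓ²`-norm empirical covering number of `H`. -/
def empiricalCoveringNumber {𝒳 : Type*} (H : Set (𝒳 → ℝ)) (ε : ℝ) : ℕ∞ :=
  ⨆ (n : ℕ) (_ : 1 ≤ n) (x : Fin n → 𝒳),
    coveringNumber d2 ((fun (f : 𝒳 → ℝ) (i : Fin n) => f (x i)) '' H) ε

end Covering

/-- MEE admissible hypothesis spaces, consisting of continuous functions. -/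
structure AdmissibleSpace {𝒳 : Type*} [TopologicalSpace 𝒳] [MeasurableSpace 𝒳]
    (ρ : Measure (𝒳 × ℝ)) (fstar : 𝒳 → ℝ) (H : Set (𝒳 → ℝ)) : Prop where
  continuous : ∀ f ∈ H, Continuous f
  bounded : ∃ M : ℝ, ∀ f ∈ H, ∀ x, |f x| ≤ M
  covering : ∃ c s : ℝ, 0 < c ∧ 0 < s ∧ s < 2 ∧ ∀ ε : ℝ, 0 < ε →
    empiricalCoveringNumber H ε ≠ ⊤ ∧
      Real.log ((empiricalCoveringNumber H ε).toNat : ℝ) ≤ c * ε ^ (-s)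
  minimizer_mem : ∃ f ∈ H, IsEntropyMinimizer ρ f
  fstar_mem : fstar ∈ H

section Algorithm

variable {𝒳 : Type*}

/-- The Gaussian kernel with bandwidth `h`. -/
def gaussKernel (h t : ℝ) : ℝ :=
  1 / (Real.sqrt (2 * Real.pi) * h) * Real.exp (-(t ^ 2 / (2 * h ^ 2)))

/-- The kernel estimate of the error density from the sample `z`. -/
def empiricalDensity (h : ℝ) {n : ℕ} (z : Fin n → 𝒳 × ℝ) (f : 𝒳 → ℝ) (e : ℝ) : ℝ :=
  (1 / (n : ℝ)) * ∑ j, gaussKernel h (e - errorVar f (z j))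

/-- The empirical error entropy. -/
def empiricalEntropy (h : ℝ) {n : ℕ} (z : Fin n → 𝒳 × ℝ) (f : 𝒳 → ℝ) : ℝ :=
  -Real.log ((1 / (n : ℝ)) * ∑ i, empiricalDensity h z f (errorVar f (z i)))

/-- The law of an i.i.d. sample of size `n`. -/
def sampleLaw [MeasurableSpace 𝒳] (ρ : Measure (𝒳 × ℝ)) (n : ℕ) :
    Measure (Fin n → 𝒳 × ℝ) :=
  Measure.pi (fun _ => ρ)

/-- `fz n z` is a minimizer over `H` of the empirical error entropy with bandwidth `h n`, for
every sample size `n ≥ 1` and almost every sample `z`. The selection of the minimizer need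
not be measurable in `z`. -/
def IsMEEAlgorithm [MeasurableSpace 𝒳] (ρ : Measure (𝒳 × ℝ)) (H : Set (𝒳 → ℝ)) (h : ℕ → ℝ)
    (fz : (n : ℕ) → (Fin n → 𝒳 × ℝ) → 𝒳 → ℝ) : Prop :=
  ∀ n : ℕ, 1 ≤ n → ∀ᵐ z ∂(sampleLaw ρ n),
    fz n z ∈ H ∧ ∀ g ∈ H, empiricalEntropy (h n) z (fz n z) ≤ empiricalEntropy (h n) z g

end Algorithm

end MEE

end

noncomputable section

namespace MEE

/-! Write `g = f* - f`, so that `E(f) = ε + g(X)`. With `A` the autocorrelation of the noise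
density, the integral of the squared error density is the mean of `A(g(X) - g(X'))` over two
independent covariates (`IsBoundedDensity.integral_shiftedDensity_sq`). As `A` is maximal at `0`,
all translates of `f*` minimize the entropy. Moreover `A(0) - A(t) ≥ c t²` on bounded intervals
(`IsBoundedDensity.exists_autocorr_drop`), as one sees by testing `p - p(· + t)` against a function
of slope one. The adjusted distance is the variance of `g`, that is, half the mean of `(g(X) -
g(X'))²`, so the drop integrates to the bound by the excess entropy, the logarithm being handled by
`log x ≤ x - 1`.

For the algorithm the comparison is made at the bandwidth in use, with the expected kernel in place
of the entropy. The Gaussian is positive definite: the smoothed autocorrelation is a cosine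
transform of the squared modulus of the noise's characteristic function against a positive measure.
Hence it too is maximal at `0`, with a quadratic drop uniform over `0 < h ≤ h₀`
(`exists_smoothedCorr_drop`). So `f*` is optimal for every smoothed criterion, no bias in `h`
arises, and only a fluctuation has to be controlled.

The empirical minimizer maximizes a U-statistic, since the diagonal terms do not depend on `f`. Its
deviations relative to `f*` are bounded by Hoeffding's averaging over disjoint pairs, a ghost
sample, random swaps (`measure_pairMean_deviation_le`) and dyadic chaining
(`exists_chaining_const`). The entropy sum converges because `s < 2`. The result is a sub-Gaussian
tail at scale `1 / (h² √n)`, where `1 / h²` is a Lipschitz constant of the kernel. For `h` of order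
`n^(-1/6)` this scale is `n^(-1/6)`. The selection of the minimizer enters only through a union of
events over `H`, which the Lindelöf property reduces to finite subfamilies. -/

lemma integral_sub_add {α : Type*} [MeasurableSpace α] {μ : Measure α} {a b c : α → ℝ}
    (ha : Integrable a μ) (hb : Integrable b μ) (hc : Integrable c μ) :
    ∫ x, (a x - b x + c x) ∂μ = ∫ x, a x ∂μ - ∫ x, b x ∂μ + ∫ x, c x ∂μ := by
  rw [integral_add (f := fun x => a x - b x) (ha.sub hb) hc, integral_sub ha hb]

/-! ### Autocorrelation of a bounded density and its drop near the origin. -/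

section Autocorrelation

/-- Bounded measurable probability densities on the line. -/
structure IsBoundedDensity (p : ℝ → ℝ) (B : ℝ) : Prop where
  measurable : Measurable p
  nonneg : ∀ t, 0 ≤ p t
  le : ∀ t, p t ≤ B
  lintegral_eq_one : ∫⁻ t, ENNReal.ofReal (p t) = 1

/-- The autocorrelation of `p`. -/
def autocorr (p : ℝ → ℝ) (t : ℝ) : ℝ := ∫ e, p e * p (e + t)

variable {p : ℝ → ℝ} {B : ℝ}

lemma IsBoundedDensity.integrable (hp : IsBoundedDensity p B) : Integrable p := by
  refine ⟨hp.measurable.aestronglyMeasurable, ?_⟩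
  rw [hasFiniteIntegral_iff_ofReal (.of_forall hp.nonneg), hp.lintegral_eq_one]
  exact ENNReal.one_lt_top

lemma IsBoundedDensity.integral_eq_one (hp : IsBoundedDensity p B) : ∫ t, p t = 1 := by
  rw [integral_eq_lintegral_of_nonneg_ae (.of_forall hp.nonneg)
    hp.measurable.aestronglyMeasurable, hp.lintegral_eq_one, ENNReal.toReal_one]

lemma IsBoundedDensity.abs_le (hp : IsBoundedDensity p B) (t : ℝ) : ‖p t‖ ≤ B := by
  rw [Real.norm_of_nonneg (hp.nonneg t)]; exact hp.le t

lemma IsBoundedDensity.integrable_mul_shift (hp : IsBoundedDensity p B) (t : ℝ) :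
    Integrable (fun e => p e * p (e + t)) :=
  hp.integrable.mul_bdd (c := B) (hp.measurable.comp (measurable_id.add_const t)).aestronglyMeasurable
    (.of_forall fun _ => hp.abs_le _)

lemma IsBoundedDensity.integrable_sq (hp : IsBoundedDensity p B) :
    Integrable (fun e => p e ^ 2) := by
  simpa [sq] using hp.integrable_mul_shift 0

lemma autocorr_zero (p : ℝ → ℝ) : autocorr p 0 = ∫ e, p e ^ 2 := by
  simp [autocorr, sq]

lemma IsBoundedDensity.integrable_sq_sub_shift (hp : IsBoundedDensity p B) (t : ℝ) :
    Integrable (fun e => (p e - p (e + t)) ^ 2) := by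
  have h2 := hp.integrable_sq.comp_add_right t
  have := (hp.integrable_sq.sub ((hp.integrable_mul_shift t).const_mul 2)).add h2
  refine this.congr (.of_forall fun e => ?_)
  simp only [Pi.add_apply, Pi.sub_apply]; ring

/-- Expanding the square and using translation invariance turns the drop of the autocorrelation into
a squared `L²` distance; maximality at `0` follows at once. -/
lemma IsBoundedDensity.integral_sq_sub_shift (hp : IsBoundedDensity p B) (t : ℝ) :
    ∫ e, (p e - p (e + t)) ^ 2 = 2 * (autocorr p 0 - autocorr p t) := by
  have h1 : ∀ e, (p e - p (e + t)) ^ 2 = (p e ^ 2 - 2 * (p e * p (e + t))) + p (e + t) ^ 2 :=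
    fun e => by ring
  simp_rw [h1]
  have h2 := hp.integrable_sq.comp_add_right t
  have h3 := (hp.integrable_mul_shift t).const_mul 2
  rw [integral_sub_add hp.integrable_sq h3 h2,
    integral_const_mul, integral_add_right_eq_self (fun e => p e ^ 2), autocorr_zero]
  simp only [autocorr]; ring

lemma IsBoundedDensity.autocorr_le (hp : IsBoundedDensity p B) (t : ℝ) :
    autocorr p t ≤ autocorr p 0 := by
  have h := hp.integral_sq_sub_shift t
  have h2 : 0 ≤ ∫ e, (p e - p (e + t)) ^ 2 := integral_nonneg fun e => sq_nonneg _
  linarith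

lemma autocorr_nonneg (hp : IsBoundedDensity p B) (t : ℝ) : 0 ≤ autocorr p t :=
  integral_nonneg fun _ => mul_nonneg (hp.nonneg _) (hp.nonneg _)

lemma IsBoundedDensity.measurable_autocorr (hp : IsBoundedDensity p B) :
    Measurable (autocorr p) := by
  have : StronglyMeasurable (Function.uncurry fun t e : ℝ => p e * p (e + t)) := by
    have := hp.measurable
    refine Measurable.stronglyMeasurable ?_
    simp only [Function.uncurry_def]
    fun_prop
  exact this.integral_prod_right.measurable

/-- A tent of slope one, centred at `R`. -/
def tent (R x : ℝ) : ℝ := max 0 (2 * R - |x - R|)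

lemma continuous_tent (R : ℝ) : Continuous (tent R) := by unfold tent; fun_prop

lemma hasCompactSupport_tent (R : ℝ) : HasCompactSupport (tent R) := by
  refine HasCompactSupport.intro (isCompact_Icc (a := -R) (b := 3 * R)) fun x hx => ?_
  simp only [Set.mem_Icc, not_and_or, not_le] at hx
  refine max_eq_left ?_
  rcases hx with hx | hx
  · have := neg_abs_le (x - R); linarith
  · have := le_abs_self (x - R); linarith

lemma abs_tent_sub_le (R x y : ℝ) : |tent R x - tent R y| ≤ |x - y| := by
  refine (abs_max_sub_max_le_max _ _ _ _).trans ?_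
  rw [sub_self, abs_zero]
  refine max_le (abs_nonneg _) ?_
  have := abs_abs_sub_abs_le_abs_sub (x - R) (y - R)
  rw [show 2 * R - |x - R| - (2 * R - |y - R|) = -(|x - R| - |y - R|) by ring, abs_neg]
  simpa using this

lemma tent_eq {R x : ℝ} (h1 : -R ≤ x) (h2 : x ≤ R) : tent R x = R + x := by
  unfold tent
  rw [abs_of_nonpos (by linarith), max_eq_right (by linarith)]; ring

/-- The autocorrelation of a density drops at least quadratically near its maximum. -/
theorem IsBoundedDensity.exists_autocorr_drop (hp : IsBoundedDensity p B) (T : ℝ) :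
    ∃ c : ℝ, 0 < c ∧ ∀ t, |t| ≤ T → c * t ^ 2 ≤ autocorr p 0 - autocorr p t := by
  -- Any share of the mass above one half would do: the part outside the interval can cost at most
  -- its own mass times `t²`.
  obtain ⟨n, hn⟩ : ∃ n : ℕ, 3 / 4 ≤ ∫ e in Set.Icc (-(n : ℝ)) n, p e := by
    have h1 : AECover (volume : Measure ℝ) atTop fun n : ℕ => Set.Icc (-(n : ℝ)) n :=
      aecover_Icc (tendsto_neg_atTop_atBot.comp tendsto_natCast_atTop_atTop)
        tendsto_natCast_atTop_atTop
    have h2 := h1.integral_tendsto_of_countably_generated hp.integrable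
    rw [hp.integral_eq_one] at h2
    exact (h2.eventually_const_le (by norm_num : (3 / 4 : ℝ) < 1)).exists
  -- With this `R`, both `e` and `e - t` lie where the tent is affine whenever `|e| ≤ n` and `|t| ≤
  -- T`.
  set R : ℝ := n + T with hR
  set θ := tent R with hθ
  have hθc : Continuous θ := continuous_tent R
  have hθs : HasCompactSupport θ := hasCompactSupport_tent R
  have hθi : Integrable (fun e => θ e ^ 2) :=
    (hθc.pow 2).integrable_of_hasCompactSupport (by
      refine hθs.mono fun x hx => ?_
      simp only [Function.mem_support, ne_eq] at hx ⊢
      intro h; simp [h] at hx)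
  obtain ⟨Cθ, hCθ⟩ := hθs.exists_bound_of_continuous hθc
  set Q : ℝ := (∫ e, θ e ^ 2) + 1 with hQ
  have hQpos : 0 < Q := by
    have : 0 ≤ ∫ e, θ e ^ 2 := integral_nonneg fun _ => sq_nonneg _
    linarith
  refine ⟨1 / (8 * Q), by positivity, fun t ht => ?_⟩
  have hpθ : ∀ s, Integrable (fun e => p e * θ (e + s)) := fun s =>
    hp.integrable.mul_bdd (c := Cθ) (hθc.comp (continuous_id.add continuous_const)).aestronglyMeasurable
      (.of_forall fun e => hCθ _)
  have hpθ0 : Integrable (fun e => p e * θ e) := by simpa using hpθ 0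
  have hpθt : Integrable (fun e => p (e + t) * θ e) := by
    have := (hpθ (-t)).comp_add_right t
    simpa using this
  have hshift : ∫ e, p (e + t) * θ e = ∫ e, p e * θ (e + -t) := by
    rw [← integral_add_right_eq_self (fun e => p e * θ (e + -t)) t]
    simp
  -- The shift is moved from `p` to the tent. Then `t (θ(e) - θ(e - t))` equals `t²` on the central
  -- interval and is at least `-t²` elsewhere, so its mean is at least `t² (2 · 3/4 - 1)`.
  have hm : t ^ 2 / 2 ≤ t * ∫ e, (p e - p (e + t)) * θ e := by
    have h1 : t * ∫ e, (p e - p (e + t)) * θ e =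
        ∫ e, p e * (t * (θ e - θ (e + -t))) := by
      simp_rw [sub_mul]
      rw [integral_sub hpθ0 hpθt, hshift, ← integral_sub hpθ0 (hpθ _), ← integral_const_mul]
      exact integral_congr_ae (.of_forall fun e => by ring)
    have hind : Integrable (Set.indicator (Set.Icc (-(n : ℝ)) n) p) :=
      hp.integrable.indicator measurableSet_Icc
    have h2 : ∫ e, t ^ 2 * (2 * Set.indicator (Set.Icc (-(n : ℝ)) n) p e - p e) =
        t ^ 2 * (2 * (∫ e in Set.Icc (-(n : ℝ)) n, p e) - 1) := by
      rw [integral_const_mul, integral_sub (hind.const_mul 2) hp.integrable, integral_const_mul,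
        integral_indicator measurableSet_Icc, hp.integral_eq_one]
    have h3 : ∫ e, t ^ 2 * (2 * Set.indicator (Set.Icc (-(n : ℝ)) n) p e - p e) ≤
        ∫ e, p e * (t * (θ e - θ (e + -t))) := by
      refine integral_mono (((hind.const_mul 2).sub hp.integrable).const_mul _) ?_ fun e => ?_
      · refine ((hpθ0.sub (hpθ (-t))).const_mul t).congr (.of_forall fun e => ?_)
        simp only [Pi.sub_apply]; ring
      · by_cases he : e ∈ Set.Icc (-(n : ℝ)) n
        · have := _root_.abs_le.1 ht
          simp only [Set.indicator_of_mem he]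
          rw [hθ, tent_eq (by linarith [he.1]) (by linarith [he.2]),
            tent_eq (by linarith [he.1]) (by linarith [he.2])]
          exact le_of_eq (by ring)
        · simp only [Set.indicator_of_notMem he]
          have h4 := abs_tent_sub_le R e (e + -t)
          rw [show e - (e + -t) = t by ring] at h4
          have h5 : |t * (θ e - θ (e + -t))| ≤ t ^ 2 := by
            rw [abs_mul, ← sq_abs t, sq]
            exact mul_le_mul_of_nonneg_left h4 (abs_nonneg _)
          have h6 := (_root_.abs_le.1 h5).1
          have := hp.nonneg e
          nlinarith
    rw [h1]
    refine le_trans ?_ h3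
    rw [h2]
    nlinarith [sq_nonneg t]
  -- Cauchy–Schwarz in the form `2 λ a b ≤ a² + λ² b²` with `λ = t / (2Q)`: the left side is at
  -- least `t² / (2Q)` and the penalty is `t² / (4Q)`, which leaves the constant `1 / (8Q)`.
  have hCS : 2 * (t / (2 * Q)) * ∫ e, (p e - p (e + t)) * θ e ≤
      2 * (autocorr p 0 - autocorr p t) + (t / (2 * Q)) ^ 2 * Q := by
    have h1 : ∫ e, 2 * (t / (2 * Q)) * ((p e - p (e + t)) * θ e) ≤
        ∫ e, ((p e - p (e + t)) ^ 2 + (t / (2 * Q)) ^ 2 * θ e ^ 2) := by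
      refine integral_mono ?_ ((hp.integrable_sq_sub_shift t).add (hθi.const_mul _)) fun e => ?_
      · refine ((hpθ0.sub hpθt).const_mul (2 * (t / (2 * Q)))).congr (.of_forall fun e => ?_)
        simp only [Pi.sub_apply]; ring
      · have := sq_nonneg ((p e - p (e + t)) - t / (2 * Q) * θ e)
        simp only
        nlinarith
    rw [integral_const_mul, integral_add (hp.integrable_sq_sub_shift t) (hθi.const_mul _),
      integral_const_mul, hp.integral_sq_sub_shift] at h1
    refine h1.trans ?_
    gcongr
    rw [hQ]; linarith
  have h7 : 2 * (t / (2 * Q)) * ∫ e, (p e - p (e + t)) * θ e =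
      (1 / Q) * (t * ∫ e, (p e - p (e + t)) * θ e) := by field_simp
  rw [h7] at hCS
  have h8 : (1 / Q) * (t ^ 2 / 2) ≤ (1 / Q) * (t * ∫ e, (p e - p (e + t)) * θ e) := by gcongr
  have h9 : (t / (2 * Q)) ^ 2 * Q = (1 / Q) * (t ^ 2 / 4) := by field_simp; ring
  have h10 : 1 / (8 * Q) * t ^ 2 = (1 / Q) * (t ^ 2 / 8) := by field_simp
  rw [h9] at hCS
  rw [h10]
  nlinarith

end Autocorrelation

/-! ### The adjusted distance as a variance. -/

section Variance

variable {𝒳 : Type*} [MeasurableSpace 𝒳]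

lemma integrable_of_bounded {α : Type*} [MeasurableSpace α] {μ : Measure α} [IsFiniteMeasure μ]
    {f : α → ℝ} (hf : Measurable f) (C : ℝ) (h : ∀ x, |f x| ≤ C) : Integrable f μ :=
  Integrable.of_bound hf.aestronglyMeasurable C (.of_forall h)

/-- The variance as a double integral. -/
lemma two_mul_integral_sq_centered (μ : Measure 𝒳) [IsProbabilityMeasure μ] {g : 𝒳 → ℝ}
    (hg : Measurable g) {T : ℝ} (hT : ∀ x, |g x| ≤ T) :
    2 * ∫ x, ((∫ u, g u ∂μ) - g x) ^ 2 ∂μ = ∫ w, (g w.1 - g w.2) ^ 2 ∂(μ.prod μ) := by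
  have hi : Integrable g μ := integrable_of_bounded hg T hT
  have hb : ∀ x, |g x ^ 2| ≤ T ^ 2 := fun x => by
    rw [abs_pow]; exact pow_le_pow_left₀ (abs_nonneg _) (hT x) 2
  have hi2 : Integrable (fun x => g x ^ 2) μ := integrable_of_bounded (hg.pow_const 2) _ hb
  set I := ∫ u, g u ∂μ with hI
  have h1 : ∫ x, (I - g x) ^ 2 ∂μ = (∫ x, g x ^ 2 ∂μ) - I ^ 2 := by
    have : ∀ x, (I - g x) ^ 2 = (I ^ 2 - 2 * I * g x) + g x ^ 2 := fun x => by ring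
    simp_rw [this]
    rw [integral_sub_add (integrable_const _) (hi.const_mul _) hi2, integral_const_mul, integral_const]
    simp only [probReal_univ, smul_eq_mul, one_mul, ← hI]; ring
  have h2 : ∀ w : 𝒳 × 𝒳, (g w.1 - g w.2) ^ 2 =
      (g w.1 ^ 2 - 2 * (g w.1 * g w.2)) + g w.2 ^ 2 := fun w => by ring
  simp_rw [h2]
  have i1 : Integrable (fun w : 𝒳 × 𝒳 => g w.1 ^ 2) (μ.prod μ) := hi2.comp_fst μ
  have i2 : Integrable (fun w : 𝒳 × 𝒳 => g w.2 ^ 2) (μ.prod μ) := hi2.comp_snd μ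
  have i3 : Integrable (fun w : 𝒳 × 𝒳 => 2 * (g w.1 * g w.2)) (μ.prod μ) :=
    (hi.mul_prod hi).const_mul 2
  rw [integral_sub_add i1 i3 i2, integral_const_mul,
    integral_prod_mul (fun x => g x) (fun x => g x), h1,
    integral_fun_fst (fun x => g x ^ 2), integral_fun_snd (fun x => g x ^ 2)]
  simp only [probReal_univ, one_smul, ← hI]; ring

/-- Adding the mean of `f* - f` centres that difference, so the adjusted distance is its variance.
-/
lemma two_mul_adjustedSqDist (ρ : Measure (𝒳 × ℝ)) [IsProbabilityMeasure ρ] {fstar f : 𝒳 → ℝ}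
    (hs : Measurable fstar) (hf : Measurable f) {T : ℝ} (hT : ∀ x, |fstar x - f x| ≤ T) :
    2 * adjustedSqDist ρ fstar f =
      ∫ w, ((fstar w.1 - f w.1) - (fstar w.2 - f w.2)) ^ 2 ∂(ρ.fst.prod ρ.fst) := by
  rw [← two_mul_integral_sq_centered ρ.fst (g := fun x => fstar x - f x) (hs.sub hf) hT,
    adjustedSqDist]
  congr 1
  refine integral_congr_ae (.of_forall fun x => ?_)
  simp only; ring

/-- A quadratic drop of `Ψ` at the origin controls the adjusted distance. -/
lemma adjustedSqDist_le_of_drop (ρ : Measure (𝒳 × ℝ)) [IsProbabilityMeasure ρ] {fstar f : 𝒳 → ℝ}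
    (hs : Measurable fstar) (hf : Measurable f) {T : ℝ} (hT : ∀ x, |fstar x - f x| ≤ T)
    {Ψ : ℝ → ℝ} (hΨ : Measurable Ψ) {K : ℝ} (hK : ∀ t, |Ψ t| ≤ K) {c : ℝ} (hc : 0 < c)
    (hdrop : ∀ t, |t| ≤ 2 * T → c * t ^ 2 ≤ Ψ 0 - Ψ t) :
    adjustedSqDist ρ fstar f ≤ 1 / (2 * c) *
      (Ψ 0 - ∫ w, Ψ ((fstar w.1 - f w.1) - (fstar w.2 - f w.2)) ∂(ρ.fst.prod ρ.fst)) := by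
  set d : 𝒳 × 𝒳 → ℝ := fun w => (fstar w.1 - f w.1) - (fstar w.2 - f w.2) with hd
  have hdm : Measurable d := by fun_prop
  have hdT : ∀ w, |d w| ≤ 2 * T := fun w => by
    refine (abs_sub _ _).trans ?_
    have := hT w.1; have := hT w.2; linarith
  have h1 : Integrable (fun w => Ψ (d w)) (ρ.fst.prod ρ.fst) :=
    integrable_of_bounded (hΨ.comp hdm) K fun w => hK _
  have h2 : Integrable (fun w => d w ^ 2) (ρ.fst.prod ρ.fst) :=
    integrable_of_bounded (hdm.pow_const 2) ((2 * T) ^ 2) fun w => by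
      rw [abs_pow]; exact pow_le_pow_left₀ (abs_nonneg _) (hdT w) 2
  have h3 : ∫ w, c * d w ^ 2 ∂(ρ.fst.prod ρ.fst) ≤ ∫ w, (Ψ 0 - Ψ (d w)) ∂(ρ.fst.prod ρ.fst) :=
    integral_mono (h2.const_mul c) ((integrable_const _).sub h1) fun w => hdrop _ (hdT w)
  rw [integral_const_mul, integral_sub (integrable_const _) h1, integral_const] at h3
  simp only [probReal_univ, one_smul] at h3
  have h4 := two_mul_adjustedSqDist ρ hs hf hT
  change _ = ∫ w, d w ^ 2 ∂(ρ.fst.prod ρ.fst) at h4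
  rw [← h4] at h3
  rw [div_mul_eq_mul_div, one_mul, le_div_iff₀ (by positivity)]
  linarith

end Variance

/-! ### Law of the error variable, optimality of `f*`, and control by the excess entropy. -/

section NoiseLaw

variable {𝒳 : Type*} [MeasurableSpace 𝒳]

/-- The covariate and the noise are independent, and the noise has the bounded density `p`. -/
structure IsNoiseLaw (ρ : Measure (𝒳 × ℝ)) (fstar : 𝒳 → ℝ) (p : ℝ → ℝ) (B : ℝ) : Prop where
  measurable : Measurable fstar
  density : IsBoundedDensity p B
  map_eq : ρ.map (fun z => (z.1, errorVar fstar z)) =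
    ρ.fst.prod (volume.withDensity fun t => ENNReal.ofReal (p t))

lemma measurable_errorVar {f : 𝒳 → ℝ} (hf : Measurable f) : Measurable (errorVar f) :=
  measurable_snd.sub (hf.comp measurable_fst)

/-- Independence makes the conditional law of the noise almost surely constant, so the conditional
density at one good point `x` is a density of the noise itself. -/
theorem AdmissibleModel.exists_noiseLaw {ρ : Measure (𝒳 × ℝ)} [IsProbabilityMeasure ρ]
    {fstar : 𝒳 → ℝ} (hmodel : AdmissibleModel ρ fstar) (hhomo : Homoskedastic ρ fstar) :
    ∃ p B, IsNoiseLaw ρ fstar p B := by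
  obtain ⟨B, p, hp, hpB⟩ := hmodel.exists_density
  have hs := hmodel.model.measurable
  have he := measurable_errorVar hs
  have hprod := (indepFun_iff_map_prod_eq_prod_map_map measurable_fst.aemeasurable
    he.aemeasurable).1 hhomo
  have hprob : IsProbabilityMeasure (ρ.map (errorVar fstar)) :=
    Measure.isProbabilityMeasure_map he.aemeasurable
  have hκ : condDistrib (errorVar fstar) Prod.fst ρ =ᵐ[ρ.map Prod.fst]
      Kernel.const 𝒳 (ρ.map (errorVar fstar)) :=
    condDistrib_ae_eq_of_measure_eq_compProd _ he.aemeasurable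
      (by rw [Measure.compProd_const]; exact hprod)
  obtain ⟨x, hx1, hx2⟩ := (hp.condLaw.and hκ).exists
  rw [hx2, Kernel.const_apply] at hx1
  have hm : Measurable (p x) := hp.measurable.comp measurable_prodMk_left
  refine ⟨p x, B, hs, ⟨hm, hp.nonneg x, hpB x, ?_⟩, ?_⟩
  · have := measure_univ (μ := ρ.map (errorVar fstar))
    rwa [hx1, withDensity_apply _ MeasurableSet.univ, Measure.restrict_univ] at this
  · rw [hprod, hx1]; rfl

/-- The density of the noise shifted by the random variable `g`. -/
def shiftedDensity (μ : Measure 𝒳) (p : ℝ → ℝ) (g : 𝒳 → ℝ) (e : ℝ) : ℝ := ∫ x, p (e - g x) ∂μ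

variable {p : ℝ → ℝ} {B : ℝ}

lemma IsBoundedDensity.ofReal_shiftedDensity (hp : IsBoundedDensity p B) (μ : Measure 𝒳)
    [IsProbabilityMeasure μ] {g : 𝒳 → ℝ} (hg : Measurable g) (e : ℝ) :
    ENNReal.ofReal (shiftedDensity μ p g e) = ∫⁻ x, ENNReal.ofReal (p (e - g x)) ∂μ := by
  have hpm := hp.measurable
  exact ofReal_integral_eq_lintegral_ofReal
    (integrable_of_bounded (by fun_prop) B fun x => hp.abs_le _)
    (.of_forall fun x => hp.nonneg _)

lemma IsBoundedDensity.shiftedDensity_nonneg (hp : IsBoundedDensity p B) (μ : Measure 𝒳)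
    (g : 𝒳 → ℝ) (e : ℝ) : 0 ≤ shiftedDensity μ p g e :=
  integral_nonneg fun _ => hp.nonneg _

/-- The collision probability density of two independent copies of the shifted noise. -/
theorem IsBoundedDensity.integral_shiftedDensity_sq (hp : IsBoundedDensity p B) (μ : Measure 𝒳)
    [IsProbabilityMeasure μ] {g : 𝒳 → ℝ} (hg : Measurable g) :
    ∫ e, shiftedDensity μ p g e ^ 2 = ∫ w, autocorr p (g w.1 - g w.2) ∂(μ.prod μ) := by
  have hpm := hp.measurable
  have h1 : ∀ e, shiftedDensity μ p g e ^ 2 =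
      ∫ w : 𝒳 × 𝒳, p (e - g w.1) * p (e - g w.2) ∂(μ.prod μ) := fun e => by
    rw [integral_prod_mul (fun x => p (e - g x)) (fun x => p (e - g x)), sq]; rfl
  simp_rw [h1]
  have hi1 : Integrable (fun q : ℝ × (𝒳 × 𝒳) => p (q.1 - g q.2.1))
      (volume.prod (μ.prod μ)) := by
    refine (integrable_prod_iff' ?_).2 ⟨.of_forall fun w => hp.integrable.comp_sub_right (g w.1), ?_⟩
    · exact (hpm.comp (by fun_prop)).aestronglyMeasurable
    · have : ∀ w : 𝒳 × 𝒳, ∫ e, ‖p (e - g w.1)‖ = 1 := fun w => by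
        simp_rw [Real.norm_of_nonneg (hp.nonneg _)]
        rw [integral_sub_right_eq_self p, hp.integral_eq_one]
      simp_rw [this]
      exact integrable_const _
  have hi : Integrable (Function.uncurry fun (e : ℝ) (w : 𝒳 × 𝒳) => p (e - g w.1) * p (e - g w.2))
      (volume.prod (μ.prod μ)) := by
    refine hi1.mul_bdd (c := B) ?_ (.of_forall fun q => hp.abs_le _)
    exact (hpm.comp (by fun_prop : Measurable fun q : ℝ × (𝒳 × 𝒳) =>
      q.1 - g q.2.2)).aestronglyMeasurable
  rw [integral_integral_swap hi]
  refine integral_congr_ae (.of_forall fun w => ?_)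
  simp only [autocorr]
  rw [← integral_add_right_eq_self _ (g w.1)]
  refine integral_congr_ae (.of_forall fun e => ?_)
  simp only
  congr 2 <;> ring

variable {ρ : Measure (𝒳 × ℝ)} [IsProbabilityMeasure ρ] {fstar : 𝒳 → ℝ}

/-- The error of `f` is the noise plus the independent variable `g(X)`, so its law is a mixture of
translates of the noise law. -/
lemma IsNoiseLaw.map_errorVar (h : IsNoiseLaw ρ fstar p B) {f : 𝒳 → ℝ} (hf : Measurable f) :
    ρ.map (errorVar f) = volume.withDensity fun e =>
      ENNReal.ofReal (shiftedDensity ρ.fst p (fun x => fstar x - f x) e) := by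
  have hpm := h.density.measurable
  have hs := h.measurable
  set g : 𝒳 → ℝ := fun x => fstar x - f x with hg
  have hgm : Measurable g := hs.sub hf
  simp_rw [h.density.ofReal_shiftedDensity ρ.fst hgm]
  have h1 : ρ.map (errorVar f) = (ρ.map fun z => (z.1, errorVar fstar z)).map
      (fun w => w.2 + g w.1) := by
    rw [Measure.map_map (by fun_prop) (measurable_fst.prodMk (measurable_errorVar hs))]
    congr 1
    funext z
    simp [errorVar, hg]
  rw [h1, h.map_eq]
  ext s hsm
  have hm : Measurable fun w : 𝒳 × ℝ => w.2 + g w.1 := by fun_prop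
  rw [Measure.map_apply hm hsm, Measure.prod_apply (hm hsm), withDensity_apply _ hsm,
    lintegral_lintegral_swap]
  · refine lintegral_congr fun x => ?_
    have hms : MeasurableSet (Prod.mk x ⁻¹' ((fun w : 𝒳 × ℝ => w.2 + g w.1) ⁻¹' s)) :=
      measurable_prodMk_left (hm hsm)
    rw [withDensity_apply _ hms, ← lintegral_indicator hms, ← lintegral_indicator hsm,
      ← lintegral_add_right_eq_self (s.indicator fun e => ENNReal.ofReal (p (e - g x))) (g x)]
    refine lintegral_congr fun e => ?_
    simp only [Set.indicator, add_sub_cancel_right]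
    rfl
  · refine Measurable.aemeasurable ?_
    simp only [Function.uncurry_def]
    fun_prop

lemma IsNoiseLaw.errorDensity_ae_eq (h : IsNoiseLaw ρ fstar p B) {f : 𝒳 → ℝ}
    (hf : Measurable f) :
    errorDensity ρ f =ᵐ[volume] shiftedDensity ρ.fst p (fun x => fstar x - f x) := by
  have hpm := h.density.measurable
  have hgm : Measurable fun x => fstar x - f x := h.measurable.sub hf
  have hs := h.measurable
  have hm : Measurable (shiftedDensity ρ.fst p (fun x => fstar x - f x)) := by
    have : StronglyMeasurable (Function.uncurry fun (e : ℝ) (x : 𝒳) => p (e - (fstar x - f x))) := by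
      refine Measurable.stronglyMeasurable ?_
      simp only [Function.uncurry_def]
      fun_prop
    exact this.integral_prod_right.measurable
  have h1 := Measure.rnDeriv_withDensity (volume : Measure ℝ) hm.ennreal_ofReal
  rw [← h.map_errorVar hf] at h1
  filter_upwards [h1] with e he
  simp only [errorDensity, pdf_def]
  rw [he, ENNReal.toReal_ofReal (h.density.shiftedDensity_nonneg _ _ _)]

lemma IsNoiseLaw.integral_errorDensity_sq (h : IsNoiseLaw ρ fstar p B) {f : 𝒳 → ℝ}
    (hf : Measurable f) :
    ∫ e, errorDensity ρ f e ^ 2 =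
      ∫ w, autocorr p ((fstar w.1 - f w.1) - (fstar w.2 - f w.2)) ∂(ρ.fst.prod ρ.fst) := by
  rw [← h.density.integral_shiftedDensity_sq ρ.fst (g := fun x => fstar x - f x)
    (h.measurable.sub hf)]
  refine integral_congr_ae ?_
  filter_upwards [h.errorDensity_ae_eq hf] with e he
  rw [he]

lemma IsNoiseLaw.integrable_autocorr (h : IsNoiseLaw ρ fstar p B) {g : 𝒳 × 𝒳 → ℝ}
    (hg : Measurable g) : Integrable (fun w => autocorr p (g w)) (ρ.fst.prod ρ.fst) :=
  integrable_of_bounded (h.density.measurable_autocorr.comp hg) (autocorr p 0) fun _ => by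
    rw [abs_of_nonneg (autocorr_nonneg h.density _)]
    exact h.density.autocorr_le _

/-- A vanishing integral would force the density to vanish almost everywhere, against its total mass
one. Positivity keeps the logarithm away from its junk value at `0`. -/
lemma IsNoiseLaw.integral_errorDensity_sq_pos (h : IsNoiseLaw ρ fstar p B) {f : 𝒳 → ℝ}
    (hf : Measurable f) : 0 < ∫ e, errorDensity ρ f e ^ 2 := by
  have hgm : Measurable fun x => fstar x - f x := h.measurable.sub hf
  set q := shiftedDensity ρ.fst p (fun x => fstar x - f x) with hq
  have heq : ∫ e, errorDensity ρ f e ^ 2 = ∫ e, q e ^ 2 := by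
    refine integral_congr_ae ?_
    filter_upwards [h.errorDensity_ae_eq hf] with e he
    rw [he]
  have hq0 : ∀ e, 0 ≤ q e := h.density.shiftedDensity_nonneg _ _
  have hone : ∫⁻ e, ENNReal.ofReal (q e) = 1 := by
    have := h.map_errorVar hf
    have h2 : (ρ.map (errorVar f)) Set.univ = 1 := by
      rw [Measure.map_apply (measurable_errorVar hf) MeasurableSet.univ, Set.preimage_univ,
        measure_univ]
    rwa [this, withDensity_apply _ MeasurableSet.univ, Measure.restrict_univ] at h2
  have hqm : AEStronglyMeasurable q volume := by
    have : AEMeasurable (errorDensity ρ f) volume :=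
      ((measurable_pdf (errorVar f) ρ volume).ennreal_toReal).aemeasurable
    exact (this.congr (h.errorDensity_ae_eq hf)).aestronglyMeasurable
  have hqi : Integrable q := by
    refine ⟨hqm, ?_⟩
    rw [hasFiniteIntegral_iff_ofReal (.of_forall hq0), hone]
    exact ENNReal.one_lt_top
  have hqB : ∀ e, ‖q e‖ ≤ B := fun e => by
    refine (norm_integral_le_of_norm_le_const (C := B) (.of_forall fun x =>
      h.density.abs_le _)).trans ?_
    simp
  have hq2 : Integrable fun e => q e ^ 2 := by
    simpa [sq] using hqi.mul_bdd (c := B) hqm (.of_forall hqB)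
  rw [heq]
  refine lt_of_le_of_ne (integral_nonneg fun _ => sq_nonneg _) fun h0 => ?_
  have h3 := (integral_eq_zero_iff_of_nonneg (fun _ => sq_nonneg _) hq2).1 h0.symm
  have h4 : ∫⁻ e, ENNReal.ofReal (q e) = 0 := by
    rw [lintegral_congr_ae (g := fun _ => 0), lintegral_zero]
    filter_upwards [h3] with e he
    have : q e = 0 := by simpa using he
    simp [this]
  rw [hone] at h4
  exact one_ne_zero h4

lemma IsNoiseLaw.integral_errorDensity_sq_add_const (h : IsNoiseLaw ρ fstar p B) (b : ℝ) :
    ∫ e, errorDensity ρ (fun x => fstar x + b) e ^ 2 = autocorr p 0 := by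
  rw [h.integral_errorDensity_sq (h.measurable.add_const b)]
  simp

lemma IsNoiseLaw.autocorr_zero_pos (h : IsNoiseLaw ρ fstar p B) : 0 < autocorr p 0 := by
  rw [← h.integral_errorDensity_sq_add_const 0]
  exact h.integral_errorDensity_sq_pos (h.measurable.add_const 0)

/-- Translates of `f*` minimize the error entropy. -/
theorem IsNoiseLaw.isEntropyMinimizer (h : IsNoiseLaw ρ fstar p B) (b : ℝ) :
    IsEntropyMinimizer ρ (fun x => fstar x + b) := by
  refine ⟨h.measurable.add_const b, fun g hg => neg_le_neg ?_⟩
  refine Real.log_le_log (h.integral_errorDensity_sq_pos hg) ?_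
  rw [h.integral_errorDensity_sq_add_const, h.integral_errorDensity_sq hg]
  have hs := h.measurable
  refine (integral_mono (h.integrable_autocorr
    (g := fun w : 𝒳 × 𝒳 => (fstar w.1 - g w.1) - (fstar w.2 - g w.2)) (by fun_prop))
    (integrable_const _) fun _ => h.density.autocorr_le _).trans ?_
  simp

/-- An infimum of reals is meaningful only for a family bounded below; the minimizing property of
`f*` supplies that bound. -/
theorem IsNoiseLaw.minEntropy_eq (h : IsNoiseLaw ρ fstar p B) :
    minEntropy ρ = errorEntropy ρ fstar := by
  have h0 := h.isEntropyMinimizer 0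
  simp only [add_zero] at h0
  have : Nonempty {f : 𝒳 → ℝ // Measurable f} := ⟨⟨fstar, h.measurable⟩⟩
  refine le_antisymm (ciInf_le ⟨errorEntropy ρ fstar, ?_⟩ (⟨fstar, h.measurable⟩ :
    {f : 𝒳 → ℝ // Measurable f})) (le_ciInf fun f => h0.2 f.1 f.2)
  rintro _ ⟨f, rfl⟩
  exact h0.2 f.1 f.2

/-- The excess error entropy controls the adjusted distance to `f*`. -/
theorem IsNoiseLaw.exists_adjustedSqDist_le (h : IsNoiseLaw ρ fstar p B) {M₀ : ℝ}
    (hM₀ : ∀ x, |fstar x| ≤ M₀) (M : ℝ) :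
    ∃ C : ℝ, 0 < C ∧ ∀ f : 𝒳 → ℝ, Measurable f → (∀ x, |f x| ≤ M) →
      adjustedSqDist ρ fstar f ≤ C * (errorEntropy ρ f - minEntropy ρ) := by
  obtain ⟨c, hc, hdrop⟩ := h.density.exists_autocorr_drop (2 * (M₀ + M))
  have hA := h.autocorr_zero_pos
  refine ⟨1 / (2 * c) * autocorr p 0, by positivity, fun f hf hM => ?_⟩
  have hT : ∀ x, |fstar x - f x| ≤ M₀ + M := fun x =>
    (abs_sub _ _).trans (add_le_add (hM₀ x) (hM x))
  refine (adjustedSqDist_le_of_drop ρ h.measurable hf hT h.density.measurable_autocorr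
    (K := autocorr p 0) (fun t => ?_) hc hdrop).trans ?_
  · rw [abs_of_nonneg (autocorr_nonneg h.density _)]
    exact h.density.autocorr_le _
  rw [mul_assoc, ← h.integral_errorDensity_sq hf]
  gcongr
  have hV := h.integral_errorDensity_sq_pos hf
  have h0 := h.integral_errorDensity_sq_add_const 0
  simp only [add_zero] at h0
  rw [h.minEntropy_eq, errorEntropy, errorEntropy, h0]
  set V := ∫ e, errorDensity ρ f e ^ 2 with hVdef
  -- `log (V / A(0)) ≤ V / A(0) - 1` bounds the deficit `A(0) - V` by `A(0)` times the excess
  -- entropy.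
  have h5 := Real.log_le_sub_one_of_pos (div_pos hV hA)
  rw [Real.log_div hV.ne' hA.ne'] at h5
  have h6 : autocorr p 0 * (V / autocorr p 0 - 1) = V - autocorr p 0 := by field_simp
  nlinarith

end NoiseLaw

lemma abs_integral_le_of_abs_le {α : Type*} [MeasurableSpace α] {μ : Measure α}
    [IsProbabilityMeasure μ] {f : α → ℝ} {C : ℝ} (h : ∀ x, |f x| ≤ C) : |∫ x, f x ∂μ| ≤ C := by
  refine (norm_integral_le_of_norm_le_const (f := f) (.of_forall h)).trans ?_
  simp

/-! ### Fourier representation of the smoothed autocorrelation and its uniform drop. -/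

section GaussianSmoothing

/-- The spectral measure of the Gaussian kernel, normalized to total mass one. -/
def kernelSpectrum (h : ℝ) : Measure ℝ := gaussianReal 0 (Real.toNNReal (1 / h ^ 2))

instance (h : ℝ) : IsProbabilityMeasure (kernelSpectrum h) := by
  unfold kernelSpectrum; infer_instance

lemma continuous_gaussKernel (h : ℝ) : Continuous (gaussKernel h) := by
  unfold gaussKernel; fun_prop

lemma gaussKernel_pos {h : ℝ} (hh : 0 < h) (t : ℝ) : 0 < gaussKernel h t := by
  unfold gaussKernel; positivity

lemma gaussKernel_le {h : ℝ} (hh : 0 < h) (t : ℝ) :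
    gaussKernel h t ≤ 1 / (Real.sqrt (2 * Real.pi) * h) := by
  unfold gaussKernel
  refine mul_le_of_le_one_right (by positivity) (Real.exp_le_one_iff.2 ?_)
  have : 0 ≤ t ^ 2 / (2 * h ^ 2) := by positivity
  linarith

lemma abs_gaussKernel_le {h : ℝ} (hh : 0 < h) (t : ℝ) :
    |gaussKernel h t| ≤ 1 / (Real.sqrt (2 * Real.pi) * h) := by
  rw [abs_of_pos (gaussKernel_pos hh t)]; exact gaussKernel_le hh t

/-- Up to normalization the Gaussian kernel is the characteristic function of a centred Gaussian of
variance `1 / h²`; the cosine is its real part. -/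
lemma gaussKernel_eq_integral_cos {h : ℝ} (hh : 0 < h) (x : ℝ) :
    gaussKernel h x =
      1 / (Real.sqrt (2 * Real.pi) * h) * ∫ ξ, Real.cos (x * ξ) ∂(kernelSpectrum h) := by
  have h1 := charFun_gaussianReal (μ := 0) (v := Real.toNNReal (1 / h ^ 2)) x
  rw [charFun_apply_real] at h1
  have h2 := congrArg Complex.re h1
  have hi : Integrable (fun ξ : ℝ => Complex.exp (x * ξ * Complex.I)) (kernelSpectrum h) := by
    refine Integrable.of_bound (by fun_prop) 1 (.of_forall fun ξ => ?_)
    rw [← Complex.ofReal_mul, Complex.norm_exp_ofReal_mul_I]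
  rw [gaussKernel]
  congr 1
  have h3 : (∫ ξ, Complex.exp (x * ξ * Complex.I) ∂(kernelSpectrum h)).re =
      ∫ ξ, Real.cos (x * ξ) ∂(kernelSpectrum h) := by
    have := integral_re hi
    simp only [RCLike.re_to_complex] at this
    rw [← this]
    refine integral_congr_ae (.of_forall fun ξ => ?_)
    simp only
    rw [← Complex.ofReal_mul, Complex.exp_ofReal_mul_I_re]
  rw [← h3]
  refine Eq.trans ?_ h2.symm
  have h4 : (x * (0 : ℝ) * Complex.I - (Real.toNNReal (1 / h ^ 2) : ℝ) * (x : ℂ) ^ 2 / 2 : ℂ) =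
      ((-(x ^ 2 / (2 * h ^ 2)) : ℝ) : ℂ) := by
    rw [Real.coe_toNNReal _ (by positivity)]
    push_cast
    have : (h : ℂ) ≠ 0 := by exact_mod_cast hh.ne'
    field_simp
    ring
  rw [h4, Complex.exp_ofReal_re]

variable (ν : Measure ℝ) [IsProbabilityMeasure ν]

/-- The expected kernel between two independent noise variables, one of them shifted. -/
def smoothedCorr (h t : ℝ) : ℝ := ∫ w : ℝ × ℝ, gaussKernel h (w.1 - w.2 + t) ∂(ν.prod ν)

/-- The squared modulus of the characteristic function. -/
def charSq (ξ : ℝ) : ℝ := ∫ w : ℝ × ℝ, Real.cos ((w.1 - w.2) * ξ) ∂(ν.prod ν)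

lemma continuous_charSq : Continuous (charSq ν) :=
  continuous_of_dominated (bound := fun _ => 1) (fun _ => by fun_prop)
    (fun _ => .of_forall fun _ => Real.abs_cos_le_one _) (integrable_const _)
    (.of_forall fun _ => by fun_prop)

lemma charSq_zero : charSq ν 0 = 1 := by simp [charSq]

lemma abs_charSq_le (ξ : ℝ) : |charSq ν ξ| ≤ 1 :=
  abs_integral_le_of_abs_le fun _ => Real.abs_cos_le_one _

/-- The difference of two independent copies is symmetric: the sine part cancels and the cosine part
is a sum of two squares. -/
lemma integral_cos_sin (ξ : ℝ) :
    charSq ν ξ = (∫ e, Real.cos (e * ξ) ∂ν) ^ 2 + (∫ e, Real.sin (e * ξ) ∂ν) ^ 2 ∧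
    ∫ w : ℝ × ℝ, Real.sin ((w.1 - w.2) * ξ) ∂(ν.prod ν) = 0 := by
  have hc : Integrable (fun e => Real.cos (e * ξ)) ν :=
    integrable_of_bounded (by fun_prop) 1 fun _ => Real.abs_cos_le_one _
  have hs : Integrable (fun e => Real.sin (e * ξ)) ν :=
    integrable_of_bounded (by fun_prop) 1 fun _ => Real.abs_sin_le_one _
  constructor
  · simp_rw [charSq, sub_mul, Real.cos_sub]
    rw [integral_add (hc.mul_prod hc) (hs.mul_prod hs),
      integral_prod_mul (fun e => Real.cos (e * ξ)) (fun e => Real.cos (e * ξ)),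
      integral_prod_mul (fun e => Real.sin (e * ξ)) (fun e => Real.sin (e * ξ))]
    ring
  · simp_rw [sub_mul, Real.sin_sub]
    rw [integral_sub (hs.mul_prod hc) (hc.mul_prod hs),
      integral_prod_mul (fun e => Real.sin (e * ξ)) (fun e => Real.cos (e * ξ)),
      integral_prod_mul (fun e => Real.cos (e * ξ)) (fun e => Real.sin (e * ξ))]
    ring

lemma charSq_nonneg (ξ : ℝ) : 0 ≤ charSq ν ξ := by
  rw [(integral_cos_sin ν ξ).1]; positivity

lemma smoothedCorr_eq {h : ℝ} (hh : 0 < h) (t : ℝ) :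
    smoothedCorr ν h t = 1 / (Real.sqrt (2 * Real.pi) * h) *
      ∫ ξ, charSq ν ξ * Real.cos (t * ξ) ∂(kernelSpectrum h) := by
  simp_rw [smoothedCorr, gaussKernel_eq_integral_cos hh]
  rw [integral_const_mul, integral_integral_swap]
  · congr 1
    refine integral_congr_ae (.of_forall fun ξ => ?_)
    simp only
    simp_rw [add_mul, Real.cos_add]
    rw [integral_sub, integral_mul_const, integral_mul_const, (integral_cos_sin ν ξ).2, zero_mul,
      sub_zero, charSq]
    · exact (integrable_of_bounded (by fun_prop) 1 fun _ => Real.abs_cos_le_one _).mul_const _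
    · exact (integrable_of_bounded (by fun_prop) 1 fun _ => Real.abs_sin_le_one _).mul_const _
  · refine integrable_of_bounded ?_ 1 fun _ => Real.abs_cos_le_one _
    simp only [Function.uncurry_def]
    fun_prop

/-- The integrand is nonnegative, so a lower bound may discard all frequencies outside a small
interval. -/
lemma smoothedCorr_sub {h : ℝ} (hh : 0 < h) (t : ℝ) :
    smoothedCorr ν h 0 - smoothedCorr ν h t = 1 / (Real.sqrt (2 * Real.pi) * h) *
      ∫ ξ, charSq ν ξ * (1 - Real.cos (t * ξ)) ∂(kernelSpectrum h) := by
  have hm := (continuous_charSq ν).measurable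
  have hi : Integrable (charSq ν) (kernelSpectrum h) := integrable_of_bounded hm 1 (abs_charSq_le ν)
  have hi2 : Integrable (fun ξ => charSq ν ξ * Real.cos (t * ξ)) (kernelSpectrum h) :=
    hi.mul_bdd (c := 1) (by fun_prop) (.of_forall fun ξ => Real.abs_cos_le_one _)
  rw [smoothedCorr_eq ν hh, smoothedCorr_eq ν hh, ← mul_sub]
  simp only [zero_mul, Real.cos_zero, mul_one, mul_sub]
  rw [integral_sub hi hi2, mul_sub]

/-- The smoothed autocorrelation drops quadratically, uniformly for bounded bandwidths. -/
theorem exists_smoothedCorr_drop {h₀ : ℝ} (hh₀ : 0 < h₀) (T : ℝ) :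
    ∃ c : ℝ, 0 < c ∧ ∀ h t : ℝ, 0 < h → h ≤ h₀ → |t| ≤ T →
      c * t ^ 2 ≤ smoothedCorr ν h 0 - smoothedCorr ν h t := by
  obtain ⟨r₁, hr₁, hr₁'⟩ : ∃ r > 0, ∀ ξ, |ξ| ≤ r → 1 / 2 ≤ charSq ν ξ := by
    have h1 : ∀ᶠ ξ in 𝓝 (0 : ℝ), 1 / 2 ≤ charSq ν ξ := by
      refine ((continuous_charSq ν).tendsto 0).eventually_const_le ?_
      rw [charSq_zero]; norm_num
    obtain ⟨r, hr, h2⟩ := Metric.nhds_basis_closedBall.eventually_iff.1 h1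
    exact ⟨r, hr, fun ξ hξ => h2 (by simpa using hξ)⟩
  -- The sign of `T` is not fixed; this majorant is positive and can be a denominator.
  set T' : ℝ := |T| + 1 with hT'
  have hT'pos : 0 < T' := by positivity
  -- On `|ξ| ≤ r` the squared characteristic function is at least `1/2`, and `|t ξ| ≤ π` puts `t ξ`
  -- in the range of the quadratic bound for the cosine.
  set r : ℝ := min r₁ (Real.pi / T') with hr
  have hrpos : 0 < r := lt_min hr₁ (by positivity)
  set c₀ : ℝ := 1 / (2 * Real.pi) * Real.exp (-(h₀ ^ 2 * r ^ 2 / 2)) * (1 / Real.pi ^ 2) with hc₀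
  refine ⟨c₀ * (2 * r ^ 3 / 3), by positivity, fun h t hh hhh ht => ?_⟩
  have hv : Real.toNNReal (1 / h ^ 2) ≠ 0 := by
    rw [ne_eq, Real.toNNReal_eq_zero, not_le]; positivity
  rw [smoothedCorr_sub ν hh]
  set J : ℝ → ℝ := (Set.Icc (-r) r).indicator fun ξ => 1 / Real.pi ^ 2 * t ^ 2 * ξ ^ 2 with hJ
  have hJm : Measurable J := Measurable.indicator (by fun_prop) measurableSet_Icc
  have hJle : ∀ ξ, J ξ ≤ charSq ν ξ * (1 - Real.cos (t * ξ)) := by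
    intro ξ
    have hcos : 0 ≤ 1 - Real.cos (t * ξ) := by linarith [Real.cos_le_one (t * ξ)]
    by_cases hξ : ξ ∈ Set.Icc (-r) r
    · rw [hJ, Set.indicator_of_mem hξ]
      have hξr : |ξ| ≤ r := abs_le.2 hξ
      have h1 := hr₁' ξ (hξr.trans (min_le_left _ _))
      have h2 : |t * ξ| ≤ Real.pi := by
        rw [abs_mul]
        calc |t| * |ξ| ≤ T' * (Real.pi / T') := by
              refine mul_le_mul ?_ (hξr.trans (min_le_right _ _)) (abs_nonneg _) hT'pos.le
              linarith [le_abs_self T]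
          _ = Real.pi := mul_div_cancel₀ _ hT'pos.ne'
      have h3 := Real.cos_le_one_sub_mul_cos_sq h2
      have h4 : 2 / Real.pi ^ 2 * (t * ξ) ^ 2 ≤ 1 - Real.cos (t * ξ) := by linarith
      calc 1 / Real.pi ^ 2 * t ^ 2 * ξ ^ 2 = 1 / 2 * (2 / Real.pi ^ 2 * (t * ξ) ^ 2) := by ring
        _ ≤ 1 / 2 * (1 - Real.cos (t * ξ)) := by gcongr
        _ ≤ _ := by gcongr
    · rw [hJ, Set.indicator_of_notMem hξ]
      exact mul_nonneg (charSq_nonneg ν ξ) hcos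
  have hb : ∀ ξ, |charSq ν ξ * (1 - Real.cos (t * ξ))| ≤ 2 := fun ξ => by
    rw [abs_mul]
    have h1 := abs_charSq_le ν ξ
    have h2 : |1 - Real.cos (t * ξ)| ≤ 2 := by
      rw [abs_le]
      constructor <;> linarith [Real.cos_le_one (t * ξ), Real.neg_one_le_cos (t * ξ)]
    nlinarith [abs_nonneg (charSq ν ξ), abs_nonneg (1 - Real.cos (t * ξ))]
  have hJ0 : ∀ ξ, 0 ≤ J ξ := fun ξ => Set.indicator_nonneg (fun ξ _ => by positivity) ξ
  have hm := (continuous_charSq ν).measurable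
  have hmono : ∫ ξ, J ξ ∂(kernelSpectrum h) ≤
      ∫ ξ, charSq ν ξ * (1 - Real.cos (t * ξ)) ∂(kernelSpectrum h) := by
    refine integral_mono (integrable_of_bounded hJm 2 fun ξ => ?_)
      (integrable_of_bounded (by fun_prop) 2 hb) hJle
    rw [abs_of_nonneg (hJ0 ξ)]
    exact ((hJle ξ).trans (le_abs_self _)).trans (hb ξ)
  refine le_trans ?_ (mul_le_mul_of_nonneg_left hmono (by positivity))
  rw [kernelSpectrum, integral_gaussianReal_eq_integral_smul hv, ← integral_const_mul]
  have hcub : ∫ ξ, (Set.Icc (-r) r).indicator (fun ξ => c₀ * t ^ 2 * ξ ^ 2) ξ =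
      c₀ * (2 * r ^ 3 / 3) * t ^ 2 := by
    rw [integral_indicator measurableSet_Icc, integral_Icc_eq_integral_Ioc,
      ← intervalIntegral.integral_of_le (by linarith), intervalIntegral.integral_const_mul,
      integral_pow]
    push_cast; ring
  rw [← hcub]
  -- The prefactor `1 / h` cancels against the height of the spectral density, of order `h`. What
  -- remains is bounded below on `|ξ| ≤ r` uniformly in `h ≤ h₀`.
  have hpdf : ∀ ξ, 1 / (Real.sqrt (2 * Real.pi) * h) *
      gaussianPDFReal 0 (Real.toNNReal (1 / h ^ 2)) ξ =
      1 / (2 * Real.pi) * Real.exp (-(h ^ 2 * ξ ^ 2 / 2)) := by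
    intro ξ
    rw [gaussianPDFReal_def]
    simp only [sub_zero]
    rw [Real.coe_toNNReal _ (by positivity), ← mul_assoc]
    congr 1
    · rw [Real.sqrt_mul (x := 2 * Real.pi) (by positivity) (1 / h ^ 2), Real.sqrt_div (by norm_num), Real.sqrt_one,
        Real.sqrt_sq hh.le]
      have h5 : Real.sqrt (2 * Real.pi) * Real.sqrt (2 * Real.pi) = 2 * Real.pi :=
        Real.mul_self_sqrt (by positivity)
      conv_rhs => rw [← h5]
      have h6 : Real.sqrt (2 * Real.pi) ≠ 0 := by positivity
      field_simp
    · congr 1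
      field_simp
  have hrhs : ∀ ξ, 1 / (Real.sqrt (2 * Real.pi) * h) *
      (gaussianPDFReal 0 (Real.toNNReal (1 / h ^ 2)) ξ • J ξ) =
      (Set.Icc (-r) r).indicator (fun ξ => 1 / (2 * Real.pi) * Real.exp (-(h ^ 2 * ξ ^ 2 / 2)) *
        (1 / Real.pi ^ 2 * t ^ 2 * ξ ^ 2)) ξ := by
    intro ξ
    rw [smul_eq_mul, ← mul_assoc, hpdf, hJ]
    by_cases hξ : ξ ∈ Set.Icc (-r) r
    · rw [Set.indicator_of_mem hξ, Set.indicator_of_mem hξ]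
    · rw [Set.indicator_of_notMem hξ, Set.indicator_of_notMem hξ, mul_zero]
  simp_rw [hrhs]
  rw [integral_indicator measurableSet_Icc, integral_indicator measurableSet_Icc]
  refine setIntegral_mono_on ?_ ?_ measurableSet_Icc fun ξ hξ => ?_
  · exact Continuous.integrableOn_Icc (by fun_prop)
  · exact Continuous.integrableOn_Icc (by fun_prop)
  · have hξr : |ξ| ≤ r := abs_le.2 hξ
    have h7 : ξ ^ 2 ≤ r ^ 2 := by rw [← sq_abs]; gcongr
    calc c₀ * t ^ 2 * ξ ^ 2 = 1 / (2 * Real.pi) * Real.exp (-(h₀ ^ 2 * r ^ 2 / 2)) *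
          (1 / Real.pi ^ 2 * t ^ 2 * ξ ^ 2) := by rw [hc₀]; ring
      _ ≤ _ := by gcongr

lemma measurable_smoothedCorr (h : ℝ) : Measurable (smoothedCorr ν h) := by
  have : StronglyMeasurable (Function.uncurry fun (t : ℝ) (w : ℝ × ℝ) =>
      gaussKernel h (w.1 - w.2 + t)) := by
    have := (continuous_gaussKernel h).measurable
    refine Measurable.stronglyMeasurable ?_
    simp only [Function.uncurry_def]
    fun_prop
  exact this.integral_prod_right.measurable

lemma abs_smoothedCorr_le {h : ℝ} (hh : 0 < h) (t : ℝ) :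
    |smoothedCorr ν h t| ≤ 1 / (Real.sqrt (2 * Real.pi) * h) :=
  abs_integral_le_of_abs_le fun _ => abs_gaussKernel_le hh _

end GaussianSmoothing

/-! ### The expected kernel and the adjusted distance. -/

section KernelCorr

variable {𝒳 : Type*} [MeasurableSpace 𝒳]

/-- The expectation of the kernel between the errors of two independent observations. -/
def kernelCorr (ρ : Measure (𝒳 × ℝ)) (h : ℝ) (f : 𝒳 → ℝ) : ℝ :=
  ∫ w : (𝒳 × ℝ) × (𝒳 × ℝ), gaussKernel h (errorVar f w.1 - errorVar f w.2) ∂(ρ.prod ρ)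

variable {p : ℝ → ℝ} {B : ℝ} {ρ : Measure (𝒳 × ℝ)} [IsProbabilityMeasure ρ] {fstar : 𝒳 → ℝ}

/-- The law of the noise. -/
def noiseMeasure (p : ℝ → ℝ) : Measure ℝ := volume.withDensity fun t => ENNReal.ofReal (p t)

lemma IsBoundedDensity.isProbabilityMeasure (hp : IsBoundedDensity p B) :
    IsProbabilityMeasure (noiseMeasure p) :=
  ⟨by rw [noiseMeasure, withDensity_apply _ MeasurableSet.univ, Measure.restrict_univ,
    hp.lintegral_eq_one]⟩

lemma integral_prod_prod_swap {α β : Type*} [MeasurableSpace α] [MeasurableSpace β]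
    (μ : Measure α) (ν : Measure β) [IsProbabilityMeasure μ] [IsProbabilityMeasure ν]
    {F : α → α → β → β → ℝ}
    (hF : Measurable fun w : (α × β) × (α × β) => F w.1.1 w.2.1 w.1.2 w.2.2)
    {C : ℝ} (hC : ∀ x x' e e', |F x x' e e'| ≤ C) :
    ∫ w : (α × β) × (α × β), F w.1.1 w.2.1 w.1.2 w.2.2 ∂((μ.prod ν).prod (μ.prod ν)) =
      ∫ w : α × α, ∫ u : β × β, F w.1 w.2 u.1 u.2 ∂(ν.prod ν) ∂(μ.prod μ) := by
  have hF2 : Measurable fun w : (α × α) × (β × β) => F w.1.1 w.1.2 w.2.1 w.2.2 :=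
    hF.comp (g := fun w : (α × β) × (α × β) => F w.1.1 w.2.1 w.1.2 w.2.2)
      (f := fun w : (α × α) × (β × β) => ((w.1.1, w.2.1), (w.1.2, w.2.2))) (by fun_prop)
  have hmeas : StronglyMeasurable fun w : α × α =>
      ∫ u : β × β, F w.1 w.2 u.1 u.2 ∂(ν.prod ν) :=
    hF2.stronglyMeasurable.integral_prod_right'
  have hbd : ∀ w : α × α, |∫ u : β × β, F w.1 w.2 u.1 u.2 ∂(ν.prod ν)| ≤ C := fun w =>
    abs_integral_le_of_abs_le fun _ => hC _ _ _ _
  have hmeas1 : StronglyMeasurable fun w : α × β =>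
      ∫ v : α × β, F w.1 v.1 w.2 v.2 ∂(μ.prod ν) :=
    hF.stronglyMeasurable.integral_prod_right'
  have hbd1 : ∀ w : α × β, |∫ v : α × β, F w.1 v.1 w.2 v.2 ∂(μ.prod ν)| ≤ C := fun w =>
    abs_integral_le_of_abs_le fun _ => hC _ _ _ _
  rw [integral_prod _ (integrable_of_bounded hF C fun _ => hC _ _ _ _),
    integral_prod _ (integrable_of_bounded hmeas1.measurable C hbd1),
    integral_prod _ (integrable_of_bounded hmeas.measurable C hbd)]
  refine integral_congr_ae (.of_forall fun x => ?_)
  simp only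
  have e1 : ∀ e, ∫ v : α × β, F x v.1 e v.2 ∂(μ.prod ν) =
      ∫ x', ∫ e', F x x' e e' ∂ν ∂μ := fun e =>
    integral_prod _ (integrable_of_bounded (hF.comp (by fun_prop :
      Measurable fun v : α × β => ((x, e), v))) C fun _ => hC _ _ _ _)
  have e2 : ∀ x', ∫ u : β × β, F x x' u.1 u.2 ∂(ν.prod ν) =
      ∫ e, ∫ e', F x x' e e' ∂ν ∂ν := fun x' =>
    integral_prod _ (integrable_of_bounded (hF.comp (by fun_prop :
      Measurable fun u : β × β => ((x, u.1), (x', u.2)))) C fun _ => hC _ _ _ _)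
  simp_rw [e1, e2]
  have hsm : StronglyMeasurable fun v : β × α => ∫ e', F x v.2 v.1 e' ∂ν := by
    have : StronglyMeasurable fun q : (β × α) × β => F x q.1.2 q.1.1 q.2 :=
      (hF.comp (by fun_prop :
        Measurable fun q : (β × α) × β => ((x, q.1.1), (q.1.2, q.2)))).stronglyMeasurable
    exact this.integral_prod_right'
  refine integral_integral_swap (f := fun e x' => ∫ e', F x x' e e' ∂ν)
    (integrable_of_bounded hsm.measurable C fun v =>
      abs_integral_le_of_abs_le fun _ => hC _ _ _ _)

/-- By independence the noise pair can be integrated out first, which leaves the smoothed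
autocorrelation at `g(X) - g(X')`. -/
lemma IsNoiseLaw.kernelCorr_eq (hN : IsNoiseLaw ρ fstar p B) {h : ℝ} (hh : 0 < h) {f : 𝒳 → ℝ}
    (hf : Measurable f) :
    kernelCorr ρ h f = ∫ w, smoothedCorr (noiseMeasure p) h
      ((fstar w.1 - f w.1) - (fstar w.2 - f w.2)) ∂(ρ.fst.prod ρ.fst) := by
  have := hN.density.isProbabilityMeasure
  have hs := hN.measurable
  have hG := (continuous_gaussKernel h).measurable
  set J : 𝒳 × ℝ → 𝒳 × ℝ := fun z => (z.1, errorVar fstar z) with hJ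
  have hJm : Measurable J := measurable_fst.prodMk (measurable_errorVar hs)
  have hmap : ρ.map J = ρ.fst.prod (noiseMeasure p) := hN.map_eq
  set F : 𝒳 → 𝒳 → ℝ → ℝ → ℝ := fun x x' e e' =>
    gaussKernel h (e - e' + ((fstar x - f x) - (fstar x' - f x'))) with hF
  have hFm : Measurable fun w : (𝒳 × ℝ) × (𝒳 × ℝ) => F w.1.1 w.2.1 w.1.2 w.2.2 := by
    simp only [hF]; fun_prop
  have h1 : kernelCorr ρ h f = ∫ w : (𝒳 × ℝ) × (𝒳 × ℝ), F w.1.1 w.2.1 w.1.2 w.2.2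
      ∂((ρ.fst.prod (noiseMeasure p)).prod (ρ.fst.prod (noiseMeasure p))) := by
    rw [← hmap, Measure.map_prod_map _ _ hJm hJm, integral_map (by fun_prop)
      hFm.aestronglyMeasurable, kernelCorr]
    refine integral_congr_ae (.of_forall fun w => ?_)
    simp only [hF, hJ, Prod.map, errorVar]
    congr 1; ring
  rw [h1]
  exact integral_prod_prod_swap ρ.fst (noiseMeasure p) hFm fun _ _ _ _ => abs_gaussKernel_le hh _

/-- A deficit of the expected kernel, compared with `f*`, controls the adjusted distance, uniformly
for bounded bandwidths. -/
theorem IsNoiseLaw.exists_adjustedSqDist_le_kernelCorr (hN : IsNoiseLaw ρ fstar p B) {M₀ : ℝ}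
    (hM₀ : ∀ x, |fstar x| ≤ M₀) (M : ℝ) {h₀ : ℝ} (hh₀ : 0 < h₀) :
    ∃ C : ℝ, 0 < C ∧ ∀ (h : ℝ) (f : 𝒳 → ℝ), 0 < h → h ≤ h₀ → Measurable f → (∀ x, |f x| ≤ M) →
      adjustedSqDist ρ fstar f ≤ C * (kernelCorr ρ h fstar - kernelCorr ρ h f) := by
  have := hN.density.isProbabilityMeasure
  obtain ⟨c, hc, hdrop⟩ := exists_smoothedCorr_drop (noiseMeasure p) hh₀ (2 * (M₀ + M))
  refine ⟨1 / (2 * c), by positivity, fun h f hh hhh hf hM => ?_⟩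
  have hT : ∀ x, |fstar x - f x| ≤ M₀ + M := fun x =>
    (abs_sub _ _).trans (add_le_add (hM₀ x) (hM x))
  have h0 : kernelCorr ρ h fstar = smoothedCorr (noiseMeasure p) h 0 := by
    rw [hN.kernelCorr_eq hh hN.measurable]; simp
  rw [h0, hN.kernelCorr_eq hh hf]
  exact adjustedSqDist_le_of_drop ρ hN.measurable hf hT (measurable_smoothedCorr _ h)
    (abs_smoothedCorr_le _ hh) hc fun t ht => hdrop h t hh hhh ht

end KernelCorr

/-! ### Chaining for signed sums. -/

section Chaining

/-- The sign attached to a Boolean: `true` means that a swap is performed. -/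
def swapSign (b : Bool) : ℝ := if b then -1 else 1

/-- The signed sum of the coordinates of `v`. -/
def signedSum {m : ℕ} (v : Fin m → ℝ) (s : Fin m → Bool) : ℝ := ∑ k, swapSign (s k) * v k

/-- The average over all sign patterns. -/
def signMean {m : ℕ} (F : (Fin m → Bool) → ℝ) : ℝ := ∑ s, (2 ^ m : ℝ)⁻¹ * F s

lemma signMean_mono {m : ℕ} {F G : (Fin m → Bool) → ℝ} (h : ∀ s, F s ≤ G s) :
    signMean F ≤ signMean G :=
  Finset.sum_le_sum fun s _ => mul_le_mul_of_nonneg_left (h s) (by positivity)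

lemma signMean_const_mul {m : ℕ} (c : ℝ) (F : (Fin m → Bool) → ℝ) :
    signMean (fun s => c * F s) = c * signMean F := by
  simp only [signMean, Finset.mul_sum]
  exact Finset.sum_congr rfl fun _ _ => by ring

lemma signMean_sum {m : ℕ} {ι : Type*} (t : Finset ι) (F : ι → (Fin m → Bool) → ℝ) :
    signMean (fun s => ∑ i ∈ t, F i s) = ∑ i ∈ t, signMean (F i) := by
  simp only [signMean, Finset.mul_sum]
  exact Finset.sum_comm

lemma sum_signWeights (m : ℕ) : ∑ _s : Fin m → Bool, (2 ^ m : ℝ)⁻¹ = 1 := by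
  simp

lemma signMean_pow_le {m : ℕ} {F : (Fin m → Bool) → ℝ} (hF : ∀ s, 0 ≤ F s) (p : ℕ) :
    signMean F ^ p ≤ signMean (fun s => F s ^ p) :=
  Real.pow_arith_mean_le_arith_mean_pow _ _ _ (fun _ _ => by positivity) (sum_signWeights m)
    (fun s _ => hF s) p

/-- The sign average of the exponential factorizes over coordinates into hyperbolic cosines, and
`cosh x ≤ exp (x² / 2)`. -/
lemma signMean_exp_le {m : ℕ} (v : Fin m → ℝ) (l : ℝ) :
    signMean (fun s => Real.exp (l * signedSum v s)) ≤ Real.exp (l ^ 2 / 2 * ∑ k, v k ^ 2) := by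
  have h1 : ∑ s : Fin m → Bool, Real.exp (l * signedSum v s) = ∏ k, (2 * Real.cosh (l * v k)) := by
    have : ∀ k, (2 * Real.cosh (l * v k)) = ∑ b : Bool, Real.exp (l * (swapSign b * v k)) := by
      intro k
      simp only [Fintype.univ_bool, Finset.mem_singleton, Bool.true_eq_false, not_false_eq_true,
        Finset.sum_insert, Finset.sum_singleton, swapSign, Real.cosh_eq]
      simp; ring
    simp_rw [this]
    rw [Finset.prod_univ_sum, Fintype.piFinset_univ]
    refine Finset.sum_congr rfl fun s _ => ?_
    rw [← Real.exp_sum, signedSum, Finset.mul_sum]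
  rw [signMean, ← Finset.mul_sum, h1, Finset.prod_mul_distrib, Finset.prod_const, Finset.card_univ,
    Fintype.card_fin, inv_mul_cancel_left₀ (by positivity), Finset.mul_sum, Real.exp_sum]
  refine Finset.prod_le_prod (fun k _ => (Real.cosh_pos _).le) fun k _ => ?_
  refine (Real.cosh_le_exp_half_sq _).trans (le_of_eq ?_)
  congr 1; ring

/-- Maximal inequality for finitely many signed sums. -/
lemma signMean_sup'_exp_le {m : ℕ} {I : Type*} (F : Finset I) (hF : F.Nonempty)
    (Y : I → Fin m → ℝ) {V : ℝ} (hV : ∀ f ∈ F, ∑ k, Y f k ^ 2 ≤ V) {p : ℕ} (hp : p ≠ 0)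
    (hcard : ((F.image Y).card : ℝ) ≤ 2 ^ p) (l : ℝ) :
    signMean (fun s => F.sup' hF fun f => Real.exp (l * signedSum (Y f) s)) ≤
      2 * Real.exp (p * l ^ 2 * V / 2) := by
  set W : (Fin m → Bool) → ℝ := fun s => F.sup' hF fun f => Real.exp (l * signedSum (Y f) s)
  have hW : ∀ s, 0 ≤ W s := fun s => by
    obtain ⟨f, hf⟩ := hF
    exact (Real.exp_pos _).le.trans
      (Finset.le_sup' (fun f => Real.exp (l * signedSum (Y f) s)) hf)
  -- After raising to the power `p`, the maximum is at most the sum over distinct vectors. Their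
  -- number, at most `2 ^ p`, contributes only a factor `2` once the `p`-th root is taken.
  have h1 : ∀ s, W s ^ p ≤ ∑ y ∈ F.image Y, Real.exp ((p * l) * signedSum y s) := by
    intro s
    obtain ⟨f, hf, hfe⟩ := F.exists_mem_eq_sup' hF fun f => Real.exp (l * signedSum (Y f) s)
    have : W s ^ p = Real.exp ((p * l) * signedSum (Y f) s) := by
      change (F.sup' hF fun f => Real.exp (l * signedSum (Y f) s)) ^ p = _
      rw [hfe, ← Real.exp_nat_mul, mul_assoc]
    rw [this]
    exact Finset.single_le_sum (f := fun y => Real.exp ((p * l) * signedSum y s))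
      (fun _ _ => (Real.exp_pos _).le) (Finset.mem_image_of_mem Y hf)
  have h2 : signMean W ^ p ≤ (2 * Real.exp (p * l ^ 2 * V / 2)) ^ p := by
    calc signMean W ^ p ≤ signMean (fun s => W s ^ p) := signMean_pow_le hW p
      _ ≤ ∑ y ∈ F.image Y, signMean (fun s => Real.exp ((p * l) * signedSum y s)) := by
          rw [← signMean_sum]; exact signMean_mono h1
      _ ≤ ∑ y ∈ F.image Y, Real.exp ((p * l) ^ 2 / 2 * V) := by
          refine Finset.sum_le_sum fun y hy => (signMean_exp_le y _).trans ?_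
          obtain ⟨f, hf, rfl⟩ := Finset.mem_image.1 hy
          gcongr
          exact hV f hf
      _ = (F.image Y).card * Real.exp ((p * l) ^ 2 / 2 * V) := by simp
      _ ≤ 2 ^ p * Real.exp ((p * l) ^ 2 / 2 * V) := by gcongr
      _ = _ := by
          rw [mul_pow 2 (Real.exp _), ← Real.exp_nat_mul]
          congr 2; ring
  exact le_of_pow_le_pow_left₀ hp (by positivity) h2

/-- Cauchy–Schwarz, with no randomness used; it disposes of the remainder beyond the last chaining
level. -/
lemma signedSum_le {m : ℕ} (v : Fin m → ℝ) (s : Fin m → Bool) {r : ℝ} (hr : 0 ≤ r)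
    (h : ∑ k, v k ^ 2 ≤ r ^ 2) : signedSum v s ≤ Real.sqrt m * r := by
  refine Real.le_sqrt_of_sq_le ?_ |>.trans (le_of_eq (?_ : Real.sqrt (m * r ^ 2) = _))
  · have h1 := sq_sum_le_card_mul_sum_sq (s := Finset.univ) (f := fun k => swapSign (s k) * v k)
    have h2 : ∑ k, (swapSign (s k) * v k) ^ 2 = ∑ k, v k ^ 2 :=
      Finset.sum_congr rfl fun k _ => by unfold swapSign; split_ifs <;> ring
    rw [h2] at h1
    simp only [Finset.card_univ, Fintype.card_fin] at h1
    exact h1.trans (by gcongr)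
  · rw [Real.sqrt_mul (by positivity), Real.sqrt_sq hr]

lemma signedSum_sub {m : ℕ} (u v : Fin m → ℝ) (s : Fin m → Bool) :
    signedSum (fun k => u k - v k) s = signedSum u s - signedSum v s := by
  simp [signedSum, mul_sub]

/-- The entropy integral over dyadic scales converges for entropy exponents below two. -/
lemma exists_dyadic_entropy_bound {c s D : ℝ} (hc : 0 < c) (hs : 0 < s) (hs2 : s < 2)
    (hD : 0 < D) : ∃ (K : ℝ) (p : ℕ → ℕ), 0 < K ∧ (∀ k, p k ≠ 0) ∧
      (∀ k, Real.exp (c * (D * (1 / 2) ^ k) ^ (-s)) * Real.exp (c * (D * (1 / 2) ^ (k + 1)) ^ (-s))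
        ≤ 2 ^ p k) ∧
      ∀ n : ℕ, ∑ k ∈ Finset.range n, Real.sqrt (p k) * (2 * (D * (1 / 2) ^ k)) ≤ K := by
  set e : ℕ → ℝ := fun k => D * (1 / 2) ^ k with he
  have hepos : ∀ k, 0 < e k := fun k => by positivity
  -- Two consecutive entropies add up to at most `2 c e(k+1)^(-s)`, and passing to base two with
  -- `log 2 ≥ 1/2` doubles this. The final `+ 1` keeps the exponent nonzero.
  set p : ℕ → ℕ := fun k => ⌈4 * c * (e (k + 1)) ^ (-s)⌉₊ + 1 with hp
  have hr : ∀ k, (e (k + 1)) ^ (-s) = (D / 2) ^ (-s) * ((2 : ℝ) ^ s) ^ k := by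
    intro k
    have : e (k + 1) = (D / 2) * ((1 / 2 : ℝ) ^ k) := by simp only [he]; ring
    rw [this, Real.mul_rpow (by positivity) (by positivity)]
    congr 1
    rw [Real.rpow_neg (by positivity), ← Real.rpow_natCast, ← Real.rpow_mul (by norm_num),
      ← Real.rpow_natCast, ← Real.rpow_mul (by norm_num), one_div,
      Real.inv_rpow (by norm_num), inv_inv, mul_comm]
  set Q : ℝ := 4 * c * (D / 2) ^ (-s) + 2 with hQ
  have hQpos : 0 < Q := by positivity
  have h2s : (1 : ℝ) ≤ 2 ^ s := Real.one_le_rpow (by norm_num) hs.le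
  have hpQ : ∀ k, (p k : ℝ) ≤ Q * ((2 : ℝ) ^ s) ^ k := by
    intro k
    have h1 : (p k : ℝ) ≤ 4 * c * (e (k + 1)) ^ (-s) + 1 + 1 := by
      simp only [hp]; push_cast
      have := (Nat.ceil_lt_add_one (a := 4 * c * (e (k + 1)) ^ (-s)) (by positivity)).le
      linarith
    have h2 : (1 : ℝ) ≤ ((2 : ℝ) ^ s) ^ k := one_le_pow₀ h2s
    rw [hr] at h1
    rw [hQ]; nlinarith
  -- The square roots of `p k` are bounded by a multiple of `2^(s k / 2)` while the scales decay
  -- like `2^(-k)`; the ratio is below one because `s < 2`.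
  set q : ℝ := Real.sqrt (2 ^ s) / 2 with hq
  have hq0 : 0 ≤ q := by positivity
  have hq1 : q < 1 := by
    rw [hq, div_lt_one (by norm_num), Real.sqrt_lt' (by norm_num)]
    calc (2 : ℝ) ^ s < 2 ^ (2 : ℝ) := Real.rpow_lt_rpow_of_exponent_lt (by norm_num) hs2
      _ = 2 ^ 2 := by norm_num
  refine ⟨Real.sqrt Q * (2 * D) * (1 - q)⁻¹, p, ?_, fun k => by simp [hp], ?_, ?_⟩
  · have : 0 < 1 - q := by linarith
    positivity
  · intro k
    rw [← Real.exp_add]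
    have hle : (e k) ^ (-s) ≤ (e (k + 1)) ^ (-s) := by
      refine Real.rpow_le_rpow_of_nonpos (hepos _) ?_ (by linarith)
      simp only [he, pow_succ]
      have : 0 < D * (1 / 2 : ℝ) ^ k := by positivity
      nlinarith
    have h3 : (1 / 2 : ℝ) ≤ Real.log 2 := by have := Real.log_two_gt_d9; linarith
    have h4 : 4 * c * (e (k + 1)) ^ (-s) ≤ p k := by
      simp only [hp]; push_cast
      have := Nat.le_ceil (4 * c * (e (k + 1)) ^ (-s))
      linarith
    rw [← Real.exp_log (show (0 : ℝ) < 2 ^ p k by positivity), Real.log_pow]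
    gcongr
    have : (0 : ℝ) ≤ p k := by positivity
    change c * (e k) ^ (-s) + c * (e (k + 1)) ^ (-s) ≤ _
    nlinarith
  · intro n
    calc ∑ k ∈ Finset.range n, Real.sqrt (p k) * (2 * (D * (1 / 2) ^ k))
        ≤ ∑ k ∈ Finset.range n, Real.sqrt Q * (2 * D) * q ^ k := by
          refine Finset.sum_le_sum fun k _ => ?_
          have : Real.sqrt (p k) ≤ Real.sqrt Q * Real.sqrt (2 ^ s) ^ k := by
            refine (Real.sqrt_le_sqrt (hpQ k)).trans (le_of_eq ?_)
            rw [Real.sqrt_mul hQpos.le]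
            congr 1
            rw [Real.sqrt_eq_iff_mul_self_eq (by positivity) (by positivity),
              ← mul_pow, Real.mul_self_sqrt (by positivity)]
          calc _ ≤ Real.sqrt Q * Real.sqrt (2 ^ s) ^ k * (2 * (D * (1 / 2) ^ k)) := by gcongr
            _ = _ := by rw [hq, div_pow, div_pow, one_pow]; ring
      _ = Real.sqrt Q * (2 * D) * ∑ k ∈ Finset.range n, q ^ k := by rw [Finset.mul_sum]
      _ ≤ _ := by
          gcongr
          exact (Summable.sum_le_tsum _ (fun _ _ => by positivity)
            (summable_geometric_of_lt_one hq0 hq1)).trans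
            (tsum_geometric_of_lt_one hq0 hq1).le

/-- Chaining bound for the exponential moment of the maximum of a process of signed sums. -/
theorem exists_chaining_const {c s D : ℝ} (hc : 0 < c) (hs : 0 < s) (hs2 : s < 2) (hD : 0 < D) :
    ∃ K : ℝ, 0 < K ∧ ∀ {I : Type*} [DecidableEq I] {m : ℕ} (X : I → Fin m → ℝ) (π : ℕ → I → I)
      (F : Finset I) (hF : F.Nonempty) (f0 : I) {a : ℝ}, 0 < a → (∀ f, π 0 f = f0) →
      (∀ k, ((F.image (π k)).card : ℝ) ≤ Real.exp (c * (D * (1 / 2) ^ k) ^ (-s))) →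
      (∀ k, ∀ f ∈ F, ∑ j, (X f j - X (π k f) j) ^ 2 ≤ (a * (D * (1 / 2) ^ k)) ^ 2) →
      ∀ l : ℝ, 0 < l →
        signMean (fun σ => F.sup' hF fun f =>
          Real.exp (l * signedSum (fun j => X f j - X f0 j) σ)) ≤
          2 * Real.exp (l ^ 2 * (K * a) ^ 2 / 2) := by
  obtain ⟨K, p, hK, hp0, hpcard, hsum⟩ := exists_dyadic_entropy_bound hc hs hs2 hD
  refine ⟨K, hK, ?_⟩
  intro I _ m X π F hF f0 a ha hπ0 hcard hdist l hl
  set e : ℕ → ℝ := fun k => D * (1 / 2) ^ k with he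
  have hepos : ∀ k, 0 < e k := fun k => by positivity
  have hedec : ∀ k, e (k + 1) ≤ e k := fun k => by
    have := hepos k
    simp only [he, pow_succ] at this ⊢
    nlinarith
  set Y : ℕ → I → Fin m → ℝ := fun k f j => X (π (k + 1) f) j - X (π k f) j with hY
  have hYV : ∀ k, ∀ f ∈ F, ∑ j, Y k f j ^ 2 ≤ (2 * a * e k) ^ 2 := by
    intro k f hf
    calc ∑ j, Y k f j ^ 2
        ≤ ∑ j, (2 * (X f j - X (π k f) j) ^ 2 + 2 * (X f j - X (π (k + 1) f) j) ^ 2) := by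
          refine Finset.sum_le_sum fun j _ => ?_
          simp only [hY]
          nlinarith [sq_nonneg ((X f j - X (π k f) j) + (X f j - X (π (k + 1) f) j))]
      _ = 2 * ∑ j, (X f j - X (π k f) j) ^ 2 + 2 * ∑ j, (X f j - X (π (k + 1) f) j) ^ 2 := by
          rw [Finset.sum_add_distrib, Finset.mul_sum, Finset.mul_sum]
      _ ≤ 2 * (a * e k) ^ 2 + 2 * (a * e (k + 1)) ^ 2 := by
          have h1 := hdist k f hf
          have h2 := hdist (k + 1) f hf
          simp only [he]; linarith
      _ ≤ 2 * (a * e k) ^ 2 + 2 * (a * e k) ^ 2 := by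
          have := hedec k
          have := (hepos (k + 1)).le
          gcongr
      _ = _ := by ring
  have hYcard : ∀ k, ((F.image (Y k)).card : ℝ) ≤ 2 ^ p k := by
    intro k
    -- An increment depends only on the two consecutive projections, so increments are counted by
    -- pairs of net points.
    have h1 : F.image (Y k) ⊆ ((F.image (π k)) ×ˢ (F.image (π (k + 1)))).image
        (fun uv => fun j => X uv.2 j - X uv.1 j) := by
      intro y hy
      obtain ⟨f, hf, rfl⟩ := Finset.mem_image.1 hy
      exact Finset.mem_image.2 ⟨(π k f, π (k + 1) f), Finset.mem_product.2
        ⟨Finset.mem_image_of_mem _ hf, Finset.mem_image_of_mem _ hf⟩, rfl⟩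
    have h2 := (Finset.card_le_card h1).trans Finset.card_image_le
    rw [Finset.card_product] at h2
    calc ((F.image (Y k)).card : ℝ) ≤ (F.image (π k)).card * (F.image (π (k + 1))).card := by
          exact_mod_cast h2
      _ ≤ _ := mul_le_mul (hcard k) (hcard (k + 1)) (by positivity) (by positivity)
      _ ≤ _ := hpcard k
  set b : ℕ → ℝ := fun k => Real.sqrt (p k) * (2 * e k) with hb
  have hbpos : ∀ k, 0 < b k := fun k => by
    have : (0 : ℝ) < p k := by exact_mod_cast Nat.pos_of_ne_zero (hp0 k)
    have := hepos k
    positivity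
  have key : ∀ n : ℕ, signMean (fun σ => F.sup' hF fun f =>
      Real.exp (l * signedSum (fun j => X f j - X f0 j) σ)) ≤
      Real.exp (l * (Real.sqrt m * (a * e (n + 1)))) *
        (2 * Real.exp (l ^ 2 * (K * a) ^ 2 / 2)) := by
    intro n
    set B : ℝ := ∑ k ∈ Finset.range (n + 1), b k with hB
    have hBpos : 0 < B := Finset.sum_pos (fun k _ => hbpos k) (by simp)
    have hBK : B ≤ K := hsum (n + 1)
    -- Convexity of `exp` with these weights splits the chain into levels. Proportionality to `√(p
    -- k) · e k` gives every level the same exponent `l² (B a)² / 2`.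
    set w : ℕ → ℝ := fun k => b k / B with hw
    have hwpos : ∀ k, 0 < w k := fun k => div_pos (hbpos k) hBpos
    have hwsum : ∑ k ∈ Finset.range (n + 1), w k = 1 := by
      simp only [hw]; rw [← Finset.sum_div, div_self hBpos.ne']
    have hpt : ∀ σ, (F.sup' hF fun f =>
        Real.exp (l * signedSum (fun j => X f j - X f0 j) σ)) ≤
        Real.exp (l * (Real.sqrt m * (a * e (n + 1)))) * ∑ k ∈ Finset.range (n + 1),
          w k * F.sup' hF fun f => Real.exp (l / w k * signedSum (Y k f) σ) := by
      intro σ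
      refine Finset.sup'_le _ _ fun f hf => ?_
      have hdecomp : l * signedSum (fun j => X f j - X f0 j) σ =
          l * signedSum (fun j => X f j - X (π (n + 1) f) j) σ +
            ∑ k ∈ Finset.range (n + 1), w k * (l / w k * signedSum (Y k f) σ) := by
        have h1 : ∀ k ∈ Finset.range (n + 1), w k * (l / w k * signedSum (Y k f) σ) =
            l * (signedSum (X (π (k + 1) f)) σ - signedSum (X (π k f)) σ) := by
          intro k _
          rw [← signedSum_sub, ← mul_assoc, mul_div_cancel₀ _ (hwpos k).ne']
        rw [Finset.sum_congr rfl h1, ← Finset.mul_sum,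
          Finset.sum_range_sub (fun k => signedSum (X (π k f)) σ), hπ0, signedSum_sub,
          signedSum_sub]
        ring
      rw [hdecomp, Real.exp_add]
      refine mul_le_mul ?_ ?_ (Real.exp_pos _).le (Real.exp_pos _).le
      · gcongr
        exact signedSum_le _ _ (by have := hepos (n + 1); positivity) (hdist (n + 1) f hf)
      · refine (convexOn_exp.map_sum_le (fun k _ => (hwpos k).le) hwsum
          (fun _ _ => Set.mem_univ _)).trans ?_
        refine Finset.sum_le_sum fun k _ => ?_
        refine mul_le_mul_of_nonneg_left ?_ (hwpos k).le
        exact Finset.le_sup' (fun f => Real.exp (l / w k * signedSum (Y k f) σ)) hf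
    refine (signMean_mono hpt).trans ?_
    rw [signMean_const_mul]
    gcongr
    rw [signMean_sum]
    calc ∑ k ∈ Finset.range (n + 1), signMean (fun σ => w k * F.sup' hF fun f =>
            Real.exp (l / w k * signedSum (Y k f) σ))
        ≤ ∑ k ∈ Finset.range (n + 1), w k * (2 * Real.exp (l ^ 2 * (K * a) ^ 2 / 2)) := by
          refine Finset.sum_le_sum fun k _ => ?_
          rw [signMean_const_mul]
          refine mul_le_mul_of_nonneg_left ?_ (hwpos k).le
          refine (signMean_sup'_exp_le F hF (Y k) (hYV k) (hp0 k) (hYcard k) _).trans ?_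
          have h1 : (p k : ℝ) * (l / w k) ^ 2 * (2 * a * e k) ^ 2 / 2
              = l ^ 2 * (B * a) ^ 2 / 2 := by
            have hpk : (0 : ℝ) < p k := by exact_mod_cast Nat.pos_of_ne_zero (hp0 k)
            have hbsq : b k ^ 2 = p k * (2 * e k) ^ 2 := by
              simp only [hb]; rw [mul_pow, Real.sq_sqrt hpk.le]
            have hb0 := (hbpos k).ne'
            simp only [hw]
            field_simp
            rw [hbsq]; ring
          rw [h1]
          gcongr
      _ = _ := by rw [← Finset.sum_mul, hwsum, one_mul]
  -- The bound holds after any finite number of levels, and the remainder factor tends to `1`.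
  have hlim : Tendsto (fun n : ℕ => Real.exp (l * (Real.sqrt m * (a * e (n + 1)))) *
        (2 * Real.exp (l ^ 2 * (K * a) ^ 2 / 2))) atTop
      (𝓝 (Real.exp (l * (Real.sqrt m * (a * (D * 0)))) *
        (2 * Real.exp (l ^ 2 * (K * a) ^ 2 / 2)))) := by
    have h0 : Tendsto (fun n : ℕ => (1 / 2 : ℝ) ^ (n + 1)) atTop (𝓝 0) :=
      (tendsto_pow_atTop_nhds_zero_of_lt_one (by norm_num) (by norm_num)).comp (tendsto_add_atTop_nat 1)
    exact ((Real.continuous_exp.tendsto _).comp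
      ((((h0.const_mul D).const_mul a).const_mul (Real.sqrt m)).const_mul l)).mul_const _
  simpa using ge_of_tendsto' hlim key

end Chaining

/-! ### U-statistics of order two as averages over disjoint pairs. -/

section PairMean

variable {Z : Type*}

/-- The U-statistic of order two with kernel `q`. -/
def pairMean {n : ℕ} (q : Z → Z → ℝ) (z : Fin n → Z) : ℝ :=
  ((n : ℝ) * (n - 1))⁻¹ * ∑ ij ∈ (Finset.univ : Finset (Fin n)).offDiag, q (z ij.1) (z ij.2)

lemma exists_perm_pair {n : ℕ} {a b a' b' : Fin n} (hab : a ≠ b) (hab' : a' ≠ b') :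
    ∃ τ : Equiv.Perm (Fin n), τ a = a' ∧ τ b = b' := by
  -- The first transposition sends `a` to `a'`, the second corrects the image of `b`; `a'` is
  -- untouched by the latter.
  refine ⟨Equiv.swap (Equiv.swap a a' b) b' * Equiv.swap a a', ?_, ?_⟩
  · rw [Equiv.Perm.mul_apply, Equiv.swap_apply_left]
    refine Equiv.swap_apply_of_ne_of_ne (fun h => hab ?_) hab'
    apply (Equiv.swap a a').injective
    rw [Equiv.swap_apply_left, ← h]
  · rw [Equiv.Perm.mul_apply, Equiv.swap_apply_left]

/-- Double counting: permutations act transitively on ordered pairs of distinct indices, and each of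
them only rearranges the off-diagonal sum. -/
lemma card_offDiag_mul_sum_perm {n : ℕ} (Q : Fin n → Fin n → ℝ) {a b : Fin n} (hab : a ≠ b) :
    ((n : ℝ) * (n - 1)) * ∑ π : Equiv.Perm (Fin n), Q (π a) (π b) =
      (n.factorial : ℝ) * ∑ ij ∈ (Finset.univ : Finset (Fin n)).offDiag, Q ij.1 ij.2 := by
  have h1 : ∀ ij ∈ (Finset.univ : Finset (Fin n)).offDiag,
      ∑ π : Equiv.Perm (Fin n), Q (π ij.1) (π ij.2) = ∑ π : Equiv.Perm (Fin n), Q (π a) (π b) := by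
    intro ij hij
    obtain ⟨τ, h1, h2⟩ := exists_perm_pair hab (Finset.mem_offDiag.1 hij).2.2
    rw [← h1, ← h2]
    exact Equiv.sum_comp (Equiv.mulRight τ) fun π : Equiv.Perm (Fin n) => Q (π a) (π b)
  have h2 : ∀ π : Equiv.Perm (Fin n),
      ∑ ij ∈ (Finset.univ : Finset (Fin n)).offDiag, Q (π ij.1) (π ij.2) =
        ∑ ij ∈ (Finset.univ : Finset (Fin n)).offDiag, Q ij.1 ij.2 := by
    intro π
    refine Finset.sum_equiv (π.prodCongr π) (fun ij => ?_) fun ij _ => rfl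
    simp [Finset.mem_offDiag]
  have h3 := Finset.sum_congr (rfl : (Finset.univ : Finset (Fin n)).offDiag = _) h1
  rw [Finset.sum_comm, Finset.sum_congr rfl fun π _ => h2 π] at h3
  simp only [Finset.sum_const, Finset.card_univ, Fintype.card_perm, Fintype.card_fin,
    nsmul_eq_mul, Finset.offDiag_card] at h3
  rw [h3, Nat.cast_sub (Nat.le_mul_self n)]
  push_cast; ring

/-- Normalized differences of `q` over disjoint pairs of observations, between a sample and its
ghost copy. -/
def blockDiff {n m : ℕ} (q : Z → Z → ℝ) (e : Fin m ⊕ Fin m ↪ Fin n) (w : Fin n → Z × Z)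
    (k : Fin m) : ℝ :=
  (m : ℝ)⁻¹ * (q (w (e (.inl k))).1 (w (e (.inr k))).1 - q (w (e (.inl k))).2 (w (e (.inr k))).2)

/-- A U-statistic is an average of means over independent blocks. -/
lemma pairMean_sub_eq_sum_perm {n m : ℕ} (hm : m ≠ 0) (q : Z → Z → ℝ)
    (e : Fin m ⊕ Fin m ↪ Fin n) (w : Fin n → Z × Z) :
    pairMean q (fun i => (w i).1) - pairMean q (fun i => (w i).2) =
      ∑ π : Equiv.Perm (Fin n),
        (n.factorial : ℝ)⁻¹ * ∑ k, blockDiff q (e.trans π.toEmbedding) w k := by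
  set Q : Fin n → Fin n → ℝ := fun i j => q (w i).1 (w j).1 - q (w i).2 (w j).2 with hQ
  have hn : 2 ≤ n := by
    have := Fintype.card_le_of_embedding e
    simp only [Fintype.card_sum, Fintype.card_fin] at this
    omega
  have hn1 : (0 : ℝ) < (n : ℝ) * (n - 1) := by
    have : (2 : ℝ) ≤ n := by exact_mod_cast hn
    nlinarith
  have hfac : (n.factorial : ℝ) ≠ 0 := by exact_mod_cast n.factorial_ne_zero
  have hm' : (m : ℝ) ≠ 0 := by exact_mod_cast hm
  have h1 : ∀ k : Fin m, ∑ π : Equiv.Perm (Fin n), Q (π (e (.inl k))) (π (e (.inr k))) =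
      ((n : ℝ) * (n - 1))⁻¹ * ((n.factorial : ℝ) *
        ∑ ij ∈ (Finset.univ : Finset (Fin n)).offDiag, Q ij.1 ij.2) := fun k => by
    rw [← card_offDiag_mul_sum_perm Q (a := e (.inl k)) (b := e (.inr k))
      (fun h => by simpa using e.injective h), inv_mul_cancel_left₀ hn1.ne']
  calc _ = ((n : ℝ) * (n - 1))⁻¹ * ∑ ij ∈ (Finset.univ : Finset (Fin n)).offDiag, Q ij.1 ij.2 := by
        simp only [pairMean, hQ, Finset.sum_sub_distrib]; ring
    _ = (n.factorial : ℝ)⁻¹ * ((m : ℝ)⁻¹ * ∑ k : Fin m,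
          ∑ π : Equiv.Perm (Fin n), Q (π (e (.inl k))) (π (e (.inr k)))) := by
        simp only [h1, Finset.sum_const, Finset.card_univ, Fintype.card_fin, nsmul_eq_mul]
        field_simp
    _ = _ := by
        simp only [Finset.mul_sum]
        rw [Finset.sum_comm]
        rfl

/-- Swap the sample with its ghost copy on the pairs selected by `s`. -/
def swapBlocks {n m : ℕ} (e : Fin m ⊕ Fin m ↪ Fin n) (s : Fin m → Bool) (w : Fin n → Z × Z)
    (i : Fin n) : Z × Z :=
  open Classical in
  if ∃ k, s k = true ∧ (i = e (.inl k) ∨ i = e (.inr k)) then (w i).swap else w i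

/-- The embedding is injective, so the pairs are disjoint and swapping one of them changes the sign
of its own difference only. -/
lemma blockDiff_swapBlocks {n m : ℕ} (q : Z → Z → ℝ) (e : Fin m ⊕ Fin m ↪ Fin n)
    (s : Fin m → Bool) (w : Fin n → Z × Z) (k : Fin m) :
    blockDiff q e (swapBlocks e s w) k = swapSign (s k) * blockDiff q e w k := by
  have h1 : (∃ k', s k' = true ∧ (e (.inl k) = e (.inl k') ∨ e (.inl k) = e (.inr k'))) ↔
      s k = true := by
    simp
  have h2 : (∃ k', s k' = true ∧ (e (.inr k) = e (.inl k') ∨ e (.inr k) = e (.inr k'))) ↔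
      s k = true := by
    simp
  unfold blockDiff swapBlocks swapSign
  simp only [h1, h2]
  by_cases h : s k = true
  · simp only [h, if_true, Prod.fst_swap, Prod.snd_swap]; ring
  · simp only [h]; simp

lemma abs_pairMean_le {n : ℕ} {q : Z → Z → ℝ} {C : ℝ} (hC : ∀ z z', |q z z'| ≤ C)
    (z : Fin n → Z) : |pairMean q z| ≤ |((n : ℝ) * (n - 1))⁻¹| *
      ((Finset.univ : Finset (Fin n)).offDiag.card * C) := by
  rw [pairMean, abs_mul]
  refine mul_le_mul_of_nonneg_left ?_ (abs_nonneg _)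
  refine (Finset.abs_sum_le_sum_abs _ _).trans ?_
  refine (Finset.sum_le_card_nsmul _ _ C fun ij _ => hC _ _).trans (by simp)

lemma abs_sup'_exp_le {I : Type*} {F : Finset I} (hF : F.Nonempty) {a : I → ℝ} {K : ℝ}
    (h : ∀ i, |a i| ≤ K) : |F.sup' hF fun i => Real.exp (a i)| ≤ Real.exp K := by
  obtain ⟨i, hi, he⟩ := F.exists_mem_eq_sup' hF fun i => Real.exp (a i)
  rw [he, abs_of_pos (Real.exp_pos _)]
  exact Real.exp_le_exp.2 ((le_abs_self _).trans (h i))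

end PairMean

/-! ### Ghost sample and exponential deviation bound. -/

section Symmetrization

variable {Z : Type*} [MeasurableSpace Z] (μ : Measure Z) [IsProbabilityMeasure μ]

/-- The swap acts coordinatewise, and exchanging two independent copies preserves `μ.prod μ`. -/
lemma measurePreserving_swapBlocks {n m : ℕ} (e : Fin m ⊕ Fin m ↪ Fin n) (s : Fin m → Bool) :
    MeasurePreserving (swapBlocks (Z := Z) e s) (Measure.pi fun _ => μ.prod μ)
      (Measure.pi fun _ => μ.prod μ) := by
  classical
  refine measurePreserving_pi (f := fun i (v : Z × Z) =>
    if ∃ k, s k = true ∧ (i = e (.inl k) ∨ i = e (.inr k)) then v.swap else v) _ _ fun i => ?_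
  by_cases h : ∃ k, s k = true ∧ (i = e (.inl k) ∨ i = e (.inr k))
  · simp only [h, if_true]
    exact Measure.measurePreserving_swap
  · simp only [h, if_false]
    exact MeasurePreserving.id _

lemma measurable_blockDiff {n m : ℕ} {q : Z → Z → ℝ} (hq : Measurable (Function.uncurry q))
    (e : Fin m ⊕ Fin m ↪ Fin n) (k : Fin m) :
    Measurable fun w : Fin n → Z × Z => blockDiff q e w k := by
  unfold blockDiff
  refine Measurable.const_mul (Measurable.sub ?_ ?_) _
  · exact hq.comp (g := Function.uncurry q)
      (f := fun w : Fin n → Z × Z => ((w (e (.inl k))).1, (w (e (.inr k))).1)) (by fun_prop)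
  · exact hq.comp (g := Function.uncurry q)
      (f := fun w : Fin n → Z × Z => ((w (e (.inl k))).2, (w (e (.inr k))).2)) (by fun_prop)

lemma measurable_pairMean {n : ℕ} {q : Z → Z → ℝ} (hq : Measurable (Function.uncurry q)) :
    Measurable (pairMean (n := n) q) := by
  unfold pairMean
  refine Measurable.const_mul (Finset.measurable_sum _ fun ij _ => ?_) _
  exact hq.comp (g := Function.uncurry q)
    (f := fun z : Fin n → Z => (z ij.1, z ij.2)) (by fun_prop)

lemma integral_pairMean {n : ℕ} (hn : 2 ≤ n) {q : Z → Z → ℝ}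
    (hq : Measurable (Function.uncurry q)) {C : ℝ} (hC : ∀ z z', |q z z'| ≤ C) :
    ∫ z : Fin n → Z, pairMean q z ∂(Measure.pi fun _ => μ) =
      ∫ w : Z × Z, q w.1 w.2 ∂(μ.prod μ) := by
  have h1 : ∀ ij ∈ (Finset.univ : Finset (Fin n)).offDiag,
      ∫ z : Fin n → Z, q (z ij.1) (z ij.2) ∂(Measure.pi fun _ => μ) =
        ∫ w : Z × Z, q w.1 w.2 ∂(μ.prod μ) := by
    intro ij hij
    have hne := (Finset.mem_offDiag.1 hij).2.2
    have hind := (iIndepFun_pi (μ := fun _ : Fin n => μ) (X := fun _ z => z)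
      (fun _ => aemeasurable_id)).indepFun hne
    have hmap := (indepFun_iff_map_prod_eq_prod_map_map (measurable_pi_apply _).aemeasurable
      (measurable_pi_apply _).aemeasurable).1 hind
    have he : ∀ i : Fin n, Measure.map (fun z : Fin n → Z => z i) (Measure.pi fun _ => μ) = μ :=
      fun i => (measurePreserving_eval (fun _ : Fin n => μ) i).map_eq
    rw [he, he] at hmap
    rw [← hmap, integral_map (by fun_prop)]
    exact hq.aestronglyMeasurable
  have hn1 : (0 : ℝ) < (n : ℝ) * (n - 1) := by
    have : (2 : ℝ) ≤ n := by exact_mod_cast hn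
    nlinarith
  simp only [pairMean]
  rw [integral_const_mul, integral_finsetSum, Finset.sum_congr rfl h1, Finset.sum_const,
    Finset.offDiag_card]
  · simp only [Finset.card_univ, Fintype.card_fin, nsmul_eq_mul]
    rw [Nat.cast_sub (Nat.le_mul_self n)]
    push_cast
    rw [← mul_assoc, show (n : ℝ) * n - n = n * (n - 1) by ring, inv_mul_cancel₀ hn1.ne', one_mul]
  · intro ij _
    refine integrable_of_bounded ?_ C fun _ => hC _ _
    exact hq.comp (g := Function.uncurry q)
      (f := fun z : Fin n → Z => (z ij.1, z ij.2)) (by fun_prop)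

variable {I : Type*}

lemma measurable_sup'_exp {α : Type*} [MeasurableSpace α] {F : Finset I} (hF : F.Nonempty)
    {a : I → α → ℝ} (ha : ∀ i, Measurable (a i)) :
    Measurable fun x => F.sup' hF fun i => Real.exp (a i x) := by
  have := Finset.measurable_sup' hF (f := fun i x => Real.exp (a i x)) fun i _ => (ha i).exp
  convert this using 2
  rw [Finset.sup'_apply]

lemma integrable_sup'_exp_block {F : Finset I} (hF : F.Nonempty) {q : I → Z → Z → ℝ}
    (hq : ∀ i, Measurable (Function.uncurry (q i))) {C : ℝ} (hC : ∀ i z z', |q i z z'| ≤ C)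
    (i0 : I) {n m : ℕ} (e : Fin m ⊕ Fin m ↪ Fin n) (l : ℝ) :
    Integrable (fun w : Fin n → Z × Z => F.sup' hF fun i =>
      Real.exp (l * ∑ k, (blockDiff (q i) e w k - blockDiff (q i0) e w k)))
        (Measure.pi fun _ => μ.prod μ) := by
  refine integrable_of_bounded (measurable_sup'_exp hF fun i => ?_)
    (Real.exp (|l| * ∑ _k : Fin m, ((m : ℝ)⁻¹ * (C + C) + (m : ℝ)⁻¹ * (C + C)))) fun w => ?_
  · refine Measurable.const_mul (Finset.measurable_sum _ fun k _ => ?_) _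
    exact (measurable_blockDiff (hq i) e k).sub (measurable_blockDiff (hq i0) e k)
  · have hbd : ∀ i k, |blockDiff (q i) e w k| ≤ (m : ℝ)⁻¹ * (C + C) := fun i k => by
      rw [blockDiff, abs_mul, abs_of_nonneg (by positivity : (0 : ℝ) ≤ (m : ℝ)⁻¹)]
      gcongr
      exact (abs_sub _ _).trans (add_le_add (hC _ _ _) (hC _ _ _))
    refine abs_sup'_exp_le hF fun i => ?_
    rw [abs_mul]
    refine mul_le_mul_of_nonneg_left ?_ (abs_nonneg _)
    refine (Finset.abs_sum_le_sum_abs _ _).trans (Finset.sum_le_sum fun k _ => ?_)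
    exact (abs_sub _ _).trans (add_le_add (hbd _ _) (hbd _ _))

/-- Random swaps bound the exponential moment of a maximum over block means. -/
lemma integral_sup'_exp_block_le {F : Finset I} (hF : F.Nonempty) {q : I → Z → Z → ℝ}
    (hq : ∀ i, Measurable (Function.uncurry (q i))) {C : ℝ} (hC : ∀ i z z', |q i z z'| ≤ C)
    (i0 : I) {n m : ℕ} (e : Fin m ⊕ Fin m ↪ Fin n) (l b : ℝ)
    (hb : ∀ w : Fin n → Z × Z, signMean (fun s => F.sup' hF fun i =>
      Real.exp (l * signedSum (fun k => blockDiff (q i) e w k - blockDiff (q i0) e w k) s)) ≤ b) :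
    ∫ w : Fin n → Z × Z, (F.sup' hF fun i =>
      Real.exp (l * ∑ k, (blockDiff (q i) e w k - blockDiff (q i0) e w k)))
        ∂(Measure.pi fun _ => μ.prod μ) ≤ b := by
  set Φ : (Fin n → Z × Z) → ℝ := fun w => F.sup' hF fun i =>
      Real.exp (l * ∑ k, (blockDiff (q i) e w k - blockDiff (q i0) e w k)) with hΦ
  have hΦi : Integrable Φ (Measure.pi fun _ => μ.prod μ) :=
    integrable_sup'_exp_block μ hF hq hC i0 e l
  have hT := fun s : Fin m → Bool => measurePreserving_swapBlocks (Z := Z) μ e s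
  have hΦT : ∀ s w, Φ (swapBlocks e s w) = F.sup' hF fun i =>
      Real.exp (l * signedSum (fun k => blockDiff (q i) e w k - blockDiff (q i0) e w k) s) := by
    intro s w
    simp only [hΦ, blockDiff_swapBlocks, signedSum, mul_sub]
  have hint : ∀ s : Fin m → Bool, Integrable (fun w => Φ (swapBlocks e s w))
      (Measure.pi fun _ => μ.prod μ) := fun s =>
    (hT s).integrable_comp_of_integrable hΦi
  have h1 : ∀ s : Fin m → Bool, ∫ w, Φ (swapBlocks e s w) ∂(Measure.pi fun _ => μ.prod μ) =
      ∫ w, Φ w ∂(Measure.pi fun _ => μ.prod μ) := fun s => by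
    rw [← integral_map (hT s).measurable.aemeasurable (by rw [(hT s).map_eq]; exact hΦi.1),
      (hT s).map_eq]
  calc ∫ w, Φ w ∂(Measure.pi fun _ => μ.prod μ)
      = ∑ s : Fin m → Bool, (2 ^ m : ℝ)⁻¹ *
          ∫ w, Φ (swapBlocks e s w) ∂(Measure.pi fun _ => μ.prod μ) := by
        simp_rw [h1]
        rw [← Finset.sum_mul, sum_signWeights, one_mul]
    _ = ∫ w, signMean (fun s => Φ (swapBlocks e s w)) ∂(Measure.pi fun _ => μ.prod μ) := by
        simp only [signMean]
        rw [integral_finsetSum _ fun s _ => (hint s).const_mul _]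
        simp_rw [integral_const_mul]
    _ ≤ ∫ _w, b ∂(Measure.pi fun _ : Fin n => μ.prod μ) := by
        refine integral_mono ?_ (integrable_const _) fun w => ?_
        · exact integrable_finsetSum _ fun s _ => (hint s).const_mul _
        · simp_rw [hΦT]; exact hb w
    _ = b := by simp

/-- Deviation inequality for finitely many U-statistics, by symmetrization. -/
theorem measure_pairMean_deviation_le {F : Finset I} (hF : F.Nonempty) {q : I → Z → Z → ℝ}
    (hq : ∀ i, Measurable (Function.uncurry (q i))) {C : ℝ} (hC : ∀ i z z', |q i z z'| ≤ C)
    (i0 : I) {n m : ℕ} (hm : m ≠ 0) (e : Fin m ⊕ Fin m ↪ Fin n)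
    {l b : ℝ} (hl : 0 < l)
    (hb : ∀ (e : Fin m ⊕ Fin m ↪ Fin n) (w : Fin n → Z × Z), signMean (fun s => F.sup' hF fun i =>
      Real.exp (l * signedSum (fun k => blockDiff (q i) e w k - blockDiff (q i0) e w k) s)) ≤ b)
    (t : ℝ) :
    (Measure.pi fun _ : Fin n => μ) {z | ∃ i ∈ F, t < (pairMean (q i) z - pairMean (q i0) z) -
        ((∫ w : Z × Z, q i w.1 w.2 ∂(μ.prod μ)) - ∫ w : Z × Z, q i0 w.1 w.2 ∂(μ.prod μ))} ≤
      ENNReal.ofReal (b * Real.exp (-(l * t))) := by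
  have hn : 2 ≤ n := by
    have := Fintype.card_le_of_embedding e
    simp only [Fintype.card_sum, Fintype.card_fin] at this
    omega
  set P : Measure (Fin n → Z) := Measure.pi fun _ => μ with hP
  set D : I → (Fin n → Z) → ℝ := fun i z => pairMean (q i) z - pairMean (q i0) z with hD
  obtain ⟨K, hK⟩ : ∃ K, ∀ i z, |D i z| ≤ K :=
    ⟨_, fun i z => (abs_sub _ _).trans
      (add_le_add (abs_pairMean_le (hC i) z) (abs_pairMean_le (hC i0) z))⟩
  have hDm : ∀ i, Measurable (D i) := fun i =>
    (measurable_pairMean (hq i)).sub (measurable_pairMean (hq i0))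
  have hDi : ∀ i, Integrable (D i) P := fun i => integrable_of_bounded (hDm i) K (hK i)
  have hED : ∀ i, (∫ w : Z × Z, q i w.1 w.2 ∂(μ.prod μ)) - ∫ w : Z × Z, q i0 w.1 w.2 ∂(μ.prod μ) =
      ∫ z, D i z ∂P := fun i => by
    rw [← integral_pairMean μ hn (hq i) (hC i), ← integral_pairMean μ hn (hq i0) (hC i0),
      ← integral_sub]
    · exact integrable_of_bounded (measurable_pairMean (hq i)) _ (abs_pairMean_le (hC i))
    · exact integrable_of_bounded (measurable_pairMean (hq i0)) _ (abs_pairMean_le (hC i0))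
  simp_rw [hED]
  set Ψ : (Fin n → Z) × (Fin n → Z) → ℝ := fun v =>
    F.sup' hF fun i => Real.exp (l * (D i v.1 - D i v.2)) with hΨ
  have hΨm : Measurable Ψ := measurable_sup'_exp hF fun i =>
    (((hDm i).comp measurable_fst).sub ((hDm i).comp measurable_snd)).const_mul l
  have hΨb : ∀ v, |Ψ v| ≤ Real.exp (l * (K + K)) := fun v =>
    abs_sup'_exp_le hF fun i => by
      rw [abs_mul, abs_of_pos hl]
      gcongr
      exact (abs_sub _ _).trans (add_le_add (hK _ _) (hK _ _))
  have hΨi : Integrable Ψ (P.prod P) := integrable_of_bounded hΨm _ hΨb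
  set S : (Fin n → Z) → ℝ := fun z =>
    F.sup' hF fun i => Real.exp (l * (D i z - ∫ z', D i z' ∂P)) with hS
  have hSm : Measurable S := measurable_sup'_exp hF fun i =>
    ((hDm i).sub_const _).const_mul l
  have hSb : ∀ z, |S z| ≤ Real.exp (l * (K + K)) := fun z =>
    abs_sup'_exp_le hF fun i => by
      rw [abs_mul, abs_of_pos hl]
      gcongr
      exact (abs_sub _ _).trans (add_le_add (hK _ _) (abs_integral_le_of_abs_le (hK i)))
  have hS0 : ∀ z, 0 ≤ S z := fun z => by
    obtain ⟨i, hi⟩ := hF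
    exact (Real.exp_pos _).le.trans
      (Finset.le_sup' (fun i => Real.exp (l * (D i z - ∫ z', D i z' ∂P))) hi)
  have hSi : Integrable S P := integrable_of_bounded hSm _ hSb
  -- Jensen's inequality in the ghost sample replaces the expectation by an independent copy.
  have hSΨ : ∀ z, S z ≤ ∫ z', Ψ (z, z') ∂P := by
    intro z
    refine Finset.sup'_le _ _ fun i hi => ?_
    have hm1 : Measurable fun z' => l * (D i z - D i z') := ((hDm i).const_sub _).const_mul l
    have hb1 : ∀ z', |l * (D i z - D i z')| ≤ l * (K + K) := fun z' => by
      rw [abs_mul, abs_of_pos hl]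
      gcongr
      exact (abs_sub _ _).trans (add_le_add (hK _ _) (hK _ _))
    have hi2 : Integrable (fun z' => Real.exp (l * (D i z - D i z'))) P :=
      integrable_of_bounded hm1.exp (Real.exp (l * (K + K))) fun z' => by
        rw [abs_of_pos (Real.exp_pos _)]
        exact Real.exp_le_exp.2 ((le_abs_self _).trans (hb1 z'))
    have hJ := convexOn_exp.map_integral_le (μ := P) Real.continuous_exp.continuousOn isClosed_univ
      (.of_forall fun _ => Set.mem_univ _) (integrable_of_bounded hm1 _ hb1) hi2
    have h2 : ∫ z', l * (D i z - D i z') ∂P = l * (D i z - ∫ z', D i z' ∂P) := by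
      rw [integral_const_mul, integral_sub (integrable_const _) (hDi i)]; simp
    rw [h2] at hJ
    refine hJ.trans (integral_mono hi2 ?_ fun z' => ?_)
    · exact integrable_of_bounded (hΨm.comp measurable_prodMk_left) _ fun z' => hΨb _
    · exact Finset.le_sup' (fun i => Real.exp (l * (D i z - D i z'))) hi
  have hmp := measurePreserving_arrowProdEquivProdArrow Z Z (Fin n) (fun _ => μ) (fun _ => μ)
  -- Jensen's inequality over permutations replaces the dependent U-statistic by sums over disjoint,
  -- hence independent, pairs.
  have hΨw : ∀ w : Fin n → Z × Z, Ψ (MeasurableEquiv.arrowProdEquivProdArrow Z Z (Fin n) w) ≤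
      ∑ π : Equiv.Perm (Fin n), (n.factorial : ℝ)⁻¹ * F.sup' hF fun i =>
        Real.exp (l * ∑ k, (blockDiff (q i) (e.trans π.toEmbedding) w k -
          blockDiff (q i0) (e.trans π.toEmbedding) w k)) := by
    intro w
    refine Finset.sup'_le _ _ fun i hi => ?_
    have h3 : l * (D i (fun j => (w j).1) - D i (fun j => (w j).2)) =
        ∑ π : Equiv.Perm (Fin n), (n.factorial : ℝ)⁻¹ *
          (l * ∑ k, (blockDiff (q i) (e.trans π.toEmbedding) w k -
            blockDiff (q i0) (e.trans π.toEmbedding) w k)) := by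
      have h4 : D i (fun j => (w j).1) - D i (fun j => (w j).2) =
          (pairMean (q i) (fun j => (w j).1) - pairMean (q i) (fun j => (w j).2)) -
          (pairMean (q i0) (fun j => (w j).1) - pairMean (q i0) (fun j => (w j).2)) := by
        simp only [hD]; ring
      rw [h4, pairMean_sub_eq_sum_perm hm (q i) e w, pairMean_sub_eq_sum_perm hm (q i0) e w,
        ← Finset.sum_sub_distrib, Finset.mul_sum]
      refine Finset.sum_congr rfl fun π _ => ?_
      rw [Finset.sum_sub_distrib]; ring
    change Real.exp (l * (D i (fun j => (w j).1) - D i (fun j => (w j).2))) ≤ _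
    rw [h3]
    refine (convexOn_exp.map_sum_le (fun π _ => by positivity) ?_
      (fun _ _ => Set.mem_univ _)).trans ?_
    · rw [Finset.sum_const, Finset.card_univ, Fintype.card_perm, Fintype.card_fin, nsmul_eq_mul,
        mul_inv_cancel₀ (by exact_mod_cast n.factorial_ne_zero)]
    · refine Finset.sum_le_sum fun π _ => mul_le_mul_of_nonneg_left ?_ (by positivity)
      exact Finset.le_sup' (fun i => Real.exp (l * ∑ k,
        (blockDiff (q i) (e.trans π.toEmbedding) w k -
          blockDiff (q i0) (e.trans π.toEmbedding) w k))) hi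
  have hbm : ∀ π : Equiv.Perm (Fin n), Integrable (fun w : Fin n → Z × Z => F.sup' hF fun i =>
        Real.exp (l * ∑ k, (blockDiff (q i) (e.trans π.toEmbedding) w k -
          blockDiff (q i0) (e.trans π.toEmbedding) w k))) (Measure.pi fun _ => μ.prod μ) := fun π =>
    integrable_sup'_exp_block μ hF hq hC i0 _ l
  have hES : ∫ z, S z ∂P ≤ b := by
    calc ∫ z, S z ∂P ≤ ∫ z, ∫ z', Ψ (z, z') ∂P ∂P :=
          integral_mono hSi hΨi.integral_prod_left hSΨ
      _ = ∫ v, Ψ v ∂(P.prod P) := (integral_prod _ hΨi).symm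
      _ = ∫ w, Ψ (MeasurableEquiv.arrowProdEquivProdArrow Z Z (Fin n) w)
            ∂(Measure.pi fun _ => μ.prod μ) := (hmp.integral_comp' Ψ).symm
      _ ≤ ∫ w, ∑ π : Equiv.Perm (Fin n), (n.factorial : ℝ)⁻¹ * F.sup' hF fun i =>
            Real.exp (l * ∑ k, (blockDiff (q i) (e.trans π.toEmbedding) w k -
              blockDiff (q i0) (e.trans π.toEmbedding) w k)) ∂(Measure.pi fun _ => μ.prod μ) := by
          refine integral_mono ?_ (integrable_finsetSum _ fun π _ => (hbm π).const_mul _) hΨw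
          exact integrable_of_bounded (hΨm.comp (MeasurableEquiv.measurable _)) _ fun w => hΨb _
      _ = ∑ π : Equiv.Perm (Fin n), (n.factorial : ℝ)⁻¹ * ∫ w, (F.sup' hF fun i =>
            Real.exp (l * ∑ k, (blockDiff (q i) (e.trans π.toEmbedding) w k -
              blockDiff (q i0) (e.trans π.toEmbedding) w k))) ∂(Measure.pi fun _ => μ.prod μ) := by
          rw [integral_finsetSum _ fun π _ => (hbm π).const_mul _]
          simp_rw [integral_const_mul]
      _ ≤ ∑ π : Equiv.Perm (Fin n), (n.factorial : ℝ)⁻¹ * b := by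
          refine Finset.sum_le_sum fun π _ => mul_le_mul_of_nonneg_left ?_ (by positivity)
          exact integral_sup'_exp_block_le μ hF hq hC i0 _ l b (hb _)
      _ = b := by
          rw [Finset.sum_const, Finset.card_univ, Fintype.card_perm, Fintype.card_fin,
            nsmul_eq_mul, mul_inv_cancel_left₀ (by exact_mod_cast n.factorial_ne_zero)]
  -- Chernoff's argument: Markov's inequality is applied to the exponential of the maximum.
  have hsub : {z | ∃ i ∈ F, t < D i z - ∫ z', D i z' ∂P} ⊆ {z | Real.exp (l * t) ≤ S z} := by
    rintro z ⟨i, hi, ht⟩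
    refine le_trans ?_ (Finset.le_sup' (fun i => Real.exp (l * (D i z - ∫ z', D i z' ∂P))) hi)
    exact Real.exp_le_exp.2 (mul_le_mul_of_nonneg_left ht.le hl.le)
  have hmk := mul_meas_ge_le_integral_of_nonneg (.of_forall hS0) hSi (Real.exp (l * t))
  refine (measure_mono hsub).trans ?_
  rw [← ofReal_measureReal]
  refine ENNReal.ofReal_le_ofReal ?_
  rw [Real.exp_neg, ← div_eq_mul_inv, le_div_iff₀ (Real.exp_pos _), mul_comm]
  exact hmk.trans hES

end Symmetrization

/-! ### Lipschitz dependence of the kernel on the regression function. -/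

section Lipschitz

lemma abs_exp_neg_sq_sub_le (x y : ℝ) :
    |Real.exp (-(x ^ 2 / 2)) - Real.exp (-(y ^ 2 / 2))| ≤ |x - y| := by
  have hd : ∀ u : ℝ, HasDerivAt (fun u : ℝ => Real.exp (-(u ^ 2 / 2)))
      (Real.exp (-(u ^ 2 / 2)) * (-u)) u := fun u => by
    have h1 := ((hasDerivAt_pow 2 u).div_const 2).neg.exp
    have h2 : -(((2 : ℕ) : ℝ) * u ^ (2 - 1) / 2) = -u := by norm_num
    rw [h2] at h1
    exact h1
  have hb : ∀ u : ℝ, ‖Real.exp (-(u ^ 2 / 2)) * (-u)‖ ≤ 1 := fun u => by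
    rw [norm_mul, norm_neg, Real.norm_eq_abs, Real.norm_eq_abs, abs_of_pos (Real.exp_pos _),
      Real.exp_neg, inv_mul_le_iff₀ (Real.exp_pos _), mul_one]
    have h1 := Real.add_one_le_exp (u ^ 2 / 2)
    have h2 := sq_abs u
    nlinarith [sq_nonneg (|u| - 1)]
  have := convex_univ.norm_image_sub_le_of_norm_hasDerivWithin_le (C := 1)
    (fun u _ => (hd u).hasDerivWithinAt) (fun u _ => hb u) (Set.mem_univ y) (Set.mem_univ x)
  simpa using this

/-- One factor `1 / h` is the height of the kernel, the other comes from rescaling its argument. -/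
lemma abs_gaussKernel_sub_le {h : ℝ} (hh : 0 < h) (s t : ℝ) :
    |gaussKernel h s - gaussKernel h t| ≤ 1 / h ^ 2 * |s - t| := by
  have h1 : ∀ u, gaussKernel h u =
      1 / (Real.sqrt (2 * Real.pi) * h) * Real.exp (-((u / h) ^ 2 / 2)) := fun u => by
    rw [gaussKernel, div_pow, div_div, mul_comm (h ^ 2) 2]
  have h2 : (1 : ℝ) ≤ Real.sqrt (2 * Real.pi) :=
    Real.one_le_sqrt.2 (by linarith [Real.pi_gt_three])
  have h3 : 1 / (Real.sqrt (2 * Real.pi) * h) ≤ 1 / h := by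
    gcongr
    nlinarith
  rw [h1, h1, ← mul_sub, abs_mul, abs_of_nonneg (by positivity)]
  calc _ ≤ 1 / h * |s / h - t / h| :=
        mul_le_mul h3 (abs_exp_neg_sq_sub_le _ _) (abs_nonneg _) (by positivity)
    _ = _ := by
        rw [← sub_div, abs_div, abs_of_pos hh]; field_simp

variable {𝒳 : Type*}

/-- The kernel between the errors of two observations. -/
def pairKernel (h : ℝ) (f : 𝒳 → ℝ) (z z' : 𝒳 × ℝ) : ℝ :=
  gaussKernel h (errorVar f z - errorVar f z')

lemma abs_pairKernel_sub_le {h : ℝ} (hh : 0 < h) (f g : 𝒳 → ℝ) (z z' : 𝒳 × ℝ) :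
    |pairKernel h f z z' - pairKernel h g z z'| ≤
      1 / h ^ 2 * (|f z.1 - g z.1| + |f z'.1 - g z'.1|) := by
  refine (abs_gaussKernel_sub_le hh _ _).trans ?_
  gcongr
  have : errorVar f z - errorVar f z' - (errorVar g z - errorVar g z') =
      -(f z.1 - g z.1) + (f z'.1 - g z'.1) := by simp only [errorVar]; ring
  rw [this]
  refine (abs_add_le _ _).trans ?_
  rw [abs_neg]

lemma sum_embedding_le {n m : ℕ} (e : Fin m ⊕ Fin m ↪ Fin n) {φ : Fin n → ℝ}
    (hφ : ∀ i, 0 ≤ φ i) : ∑ k, (φ (e (.inl k)) + φ (e (.inr k))) ≤ ∑ i, φ i := by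
  rw [Finset.sum_add_distrib, ← Fintype.sum_sum_type (fun x => φ (e x)),
    ← Finset.sum_map Finset.univ e φ]
  exact Finset.sum_le_sum_of_subset_of_nonneg (Finset.subset_univ _) fun i _ _ => hφ i

/-- Each pair involves four evaluations, two of the sample and two of its ghost; the square of their
sum gives the factor `4`. Disjointness of the pairs lets the total be bounded by one sum over all
observations. -/
lemma sum_sq_blockDiff_sub_le {n m : ℕ} {h : ℝ} (hh : 0 < h) (e : Fin m ⊕ Fin m ↪ Fin n)
    (w : Fin n → (𝒳 × ℝ) × (𝒳 × ℝ)) (f g : 𝒳 → ℝ) :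
    ∑ k, (blockDiff (pairKernel h f) e w k - blockDiff (pairKernel h g) e w k) ^ 2 ≤
      4 * ((m : ℝ)⁻¹ * (1 / h ^ 2)) ^ 2 * ∑ i, ((f (w i).1.1 - g (w i).1.1) ^ 2 +
        (f (w i).2.1 - g (w i).2.1) ^ 2) := by
  set φ : Fin n → ℝ := fun i => (f (w i).1.1 - g (w i).1.1) ^ 2 + (f (w i).2.1 - g (w i).2.1) ^ 2
    with hφ
  have hφ0 : ∀ i, 0 ≤ φ i := fun i => by positivity
  refine le_trans ?_ (mul_le_mul_of_nonneg_left (sum_embedding_le e hφ0) (by positivity))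
  rw [Finset.mul_sum]
  refine Finset.sum_le_sum fun k _ => ?_
  have h1 := abs_pairKernel_sub_le hh f g (w (e (.inl k))).1 (w (e (.inr k))).1
  have h2 := abs_pairKernel_sub_le hh f g (w (e (.inl k))).2 (w (e (.inr k))).2
  set A := |f (w (e (.inl k))).1.1 - g (w (e (.inl k))).1.1| with hA
  set B := |f (w (e (.inr k))).1.1 - g (w (e (.inr k))).1.1| with hB
  set A' := |f (w (e (.inl k))).2.1 - g (w (e (.inl k))).2.1| with hA'
  set B' := |f (w (e (.inr k))).2.1 - g (w (e (.inr k))).2.1| with hB'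
  have h3 : |blockDiff (pairKernel h f) e w k - blockDiff (pairKernel h g) e w k| ≤
      (m : ℝ)⁻¹ * (1 / h ^ 2) * (A + B + (A' + B')) := by
    rw [blockDiff, blockDiff, ← mul_sub, abs_mul, abs_of_nonneg (by positivity), mul_assoc]
    gcongr
    rw [sub_sub_sub_comm, mul_add]
    exact (abs_sub _ _).trans (add_le_add h1 h2)
  have h4 : φ (e (.inl k)) + φ (e (.inr k)) = A ^ 2 + A' ^ 2 + (B ^ 2 + B' ^ 2) := by
    simp only [hφ, hA, hB, hA', hB', sq_abs]
  rw [h4, ← sq_abs]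
  calc _ ≤ ((m : ℝ)⁻¹ * (1 / h ^ 2) * (A + B + (A' + B'))) ^ 2 := by gcongr
    _ = ((m : ℝ)⁻¹ * (1 / h ^ 2)) ^ 2 * (A + B + (A' + B')) ^ 2 := by ring
    _ ≤ ((m : ℝ)⁻¹ * (1 / h ^ 2)) ^ 2 * (4 * (A ^ 2 + A' ^ 2 + (B ^ 2 + B' ^ 2))) := by
        gcongr
        nlinarith [sq_nonneg (A - B), sq_nonneg (A - A'), sq_nonneg (A - B'), sq_nonneg (B - A'),
          sq_nonneg (B - B'), sq_nonneg (A' - B')]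
    _ = _ := by ring

end Lipschitz

/-! ### Nets from empirical covering numbers. -/

section Nets

variable {𝒳 : Type*} {H : Set (𝒳 → ℝ)} {ε : ℝ}

lemma sum_sq_le_of_d2_lt {N : ℕ} {a b : Fin N → ℝ} (hN : 1 ≤ N) (hε : 0 < ε)
    (h : d2 a b < ε) : ∑ i, (a i - b i) ^ 2 ≤ N * ε ^ 2 := by
  rw [d2, Real.sqrt_lt' hε] at h
  have hN' : (0 : ℝ) < N := by exact_mod_cast hN
  simp only [sq_abs] at h
  rw [one_div, inv_mul_lt_iff₀ hN'] at h
  exact h.le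

/-- Proper nets of controlled size from bounds on the empirical covering number. -/
lemma exists_net (hε : 0 < ε) (hfin : empiricalCoveringNumber H ε ≠ ⊤) {N : ℕ} (hN : 1 ≤ N)
    (x : Fin N → 𝒳) : ∃ π : (𝒳 → ℝ) → 𝒳 → ℝ,
      (∀ f ∈ H, ∑ i, (f (x i) - π f (x i)) ^ 2 ≤ N * (2 * ε) ^ 2) ∧
      ∀ F : Finset (𝒳 → ℝ), ↑F ⊆ H → ∀ [DecidableEq (𝒳 → ℝ)],
        (F.image π).card ≤ (empiricalCoveringNumber H ε).toNat := by
  classical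
  set E := (empiricalCoveringNumber H ε).toNat with hE
  set S : Set (Fin N → ℝ) := (fun (f : 𝒳 → ℝ) (i : Fin N) => f (x i)) '' H with hS
  have h1 : coveringNumber d2 S ε ≤ E := by
    rw [hE, ENat.natCast_toNat hfin, empiricalCoveringNumber]
    exact le_iSup_of_le N (le_iSup_of_le hN (le_iSup_of_le x le_rfl))
  have h2 : coveringNumber d2 S ε < (E + 1 : ℕ) :=
    h1.trans_lt (by exact_mod_cast Nat.lt_succ_self E)
  simp only [coveringNumber, iInf_lt_iff] at h2
  obtain ⟨t, ht, htE⟩ := h2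
  have htE' : t.encard ≤ E := by
    have : t.encard < (E : ℕ∞) + 1 := by exact_mod_cast htE
    exact ENat.lt_add_one_iff (ENat.natCast_ne_top E) |>.1 this
  have hc : ∀ f : 𝒳 → ℝ, ∃ a : Fin N → ℝ, f ∈ H → a ∈ t ∧ d2 (fun i => f (x i)) a < ε := by
    intro f
    by_cases hf : f ∈ H
    · have := ht ⟨f, hf, rfl⟩
      simp only [Set.mem_iUnion, Set.mem_ofPred_eq, exists_prop] at this
      obtain ⟨a, ha, hd⟩ := this
      exact ⟨a, fun _ => ⟨ha, hd⟩⟩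
    · exact ⟨0, fun h => absurd h hf⟩
  choose ctr hctr using hc
  -- Centres are arbitrary vectors. Each useful one is replaced by a function with nearby values at
  -- the sample points, which doubles the radius; the choice depends on the centre alone, so the
  -- count does not grow.
  have hr : ∀ a : Fin N → ℝ, ∃ g : 𝒳 → ℝ, (∃ f ∈ H, d2 (fun i => f (x i)) a < ε) →
      d2 (fun i => g (x i)) a < ε := by
    intro a
    by_cases ha : ∃ f ∈ H, d2 (fun i => f (x i)) a < ε
    · obtain ⟨f, _, hd⟩ := ha
      exact ⟨f, fun _ => hd⟩
    · exact ⟨0, fun h => absurd h ha⟩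
  choose rep hrep using hr
  refine ⟨fun f => rep (ctr f), fun f hf => ?_, fun F hF _ => ?_⟩
  · have h3 := sum_sq_le_of_d2_lt hN hε (hctr f hf).2
    have h4 := sum_sq_le_of_d2_lt hN hε (hrep (ctr f) ⟨f, hf, (hctr f hf).2⟩)
    calc ∑ i, (f (x i) - rep (ctr f) (x i)) ^ 2
        ≤ ∑ i, (2 * (f (x i) - ctr f i) ^ 2 + 2 * (rep (ctr f) (x i) - ctr f i) ^ 2) := by
          refine Finset.sum_le_sum fun i _ => ?_
          nlinarith [sq_nonneg ((f (x i) - ctr f i) + (rep (ctr f) (x i) - ctr f i))]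
      _ ≤ _ := by
          rw [Finset.sum_add_distrib, ← Finset.mul_sum, ← Finset.mul_sum]
          nlinarith
  · have h5 : ((F.image fun f => rep (ctr f) : Finset (𝒳 → ℝ)) : Set (𝒳 → ℝ)) ⊆ rep '' t := by
      intro g hg
      simp only [Finset.coe_image, Set.mem_image, Finset.mem_coe] at hg
      obtain ⟨f, hf, rfl⟩ := hg
      exact ⟨ctr f, (hctr f (hF hf)).1, rfl⟩
    have h6 := ((Set.encard_le_encard h5).trans (Set.encard_image_le rep t)).trans htE'
    rw [Set.encard_coe_eq_coe_finsetCard] at h6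
    exact_mod_cast h6

end Nets

/-! ### Uniform deviations over the hypothesis space. -/

section Deviation

variable {𝒳 : Type*} [MetricSpace 𝒳] [MeasurableSpace 𝒳] [BorelSpace 𝒳]

lemma exists_pair_embedding {n : ℕ} (hn : 2 ≤ n) :
    ∃ m : ℕ, m ≠ 0 ∧ (n : ℝ) ≤ 3 * m ∧ Nonempty (Fin m ⊕ Fin m ↪ Fin n) := by
  refine ⟨n / 2, by omega, ?_, ⟨(finSumFinEquiv.toEmbedding).trans
    (Fin.castLEEmb (by omega))⟩⟩
  have : n ≤ 3 * (n / 2) := by omega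
  exact_mod_cast this

/-- Sub-Gaussian deviations of the U-statistics with Gaussian kernel, for finitely many functions,
uniformly in the number of functions. -/
theorem AdmissibleSpace.exists_finite_deviation {ρ : Measure (𝒳 × ℝ)} [IsProbabilityMeasure ρ]
    {fstar : 𝒳 → ℝ} {H : Set (𝒳 → ℝ)} (hH : AdmissibleSpace ρ fstar H) :
    ∃ K : ℝ, 0 < K ∧ ∀ (n : ℕ) (h t : ℝ), 2 ≤ n → 0 < h → 0 < t →
      ∀ F : Finset (𝒳 → ℝ), F.Nonempty → ↑F ⊆ H →
      sampleLaw ρ n {z | ∃ f ∈ F, t <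
        (pairMean (pairKernel h f) z - pairMean (pairKernel h fstar) z) -
          (kernelCorr ρ h f - kernelCorr ρ h fstar)} ≤
        ENNReal.ofReal (2 * Real.exp (-(t ^ 2 / (2 * (K / (h ^ 2 * Real.sqrt n)) ^ 2)))) := by
  classical
  obtain ⟨M, hM⟩ := hH.bounded
  obtain ⟨c, s, hc, hs, hs2, hcov⟩ := hH.covering
  -- At this scale the single function `f*` serves as the coarsest net.
  set D : ℝ := 2 * |M| + 1 with hD
  have hDpos : 0 < D := by positivity
  have hfg : ∀ f ∈ H, ∀ x, |f x - fstar x| ≤ D := fun f hf x => by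
    refine (abs_sub _ _).trans ?_
    have h1 := hM f hf x
    have h2 := hM fstar hH.fstar_mem x
    linarith [le_abs_self M]
  obtain ⟨K, hK, hchain⟩ := exists_chaining_const hc hs hs2 hDpos
  refine ⟨K * 18, by positivity, fun n h t hn hh ht F hF hFH => ?_⟩
  obtain ⟨m, hm, hnm, ⟨e⟩⟩ := exists_pair_embedding hn
  have hn0 : (0 : ℝ) < n := by exact_mod_cast (by omega : 0 < n)
  have hm0 : (0 : ℝ) < m := by exact_mod_cast Nat.pos_of_ne_zero hm
  set a : ℝ := 18 / (h ^ 2 * Real.sqrt n) with ha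
  have hapos : 0 < a := by positivity
  have hchainF : ∀ (e : Fin m ⊕ Fin m ↪ Fin n) (w : Fin n → (𝒳 × ℝ) × (𝒳 × ℝ)) (l : ℝ), 0 < l →
      signMean (fun σ => F.sup' hF fun f => Real.exp (l * signedSum (fun k =>
        blockDiff (pairKernel h f) e w k - blockDiff (pairKernel h fstar) e w k) σ)) ≤
      2 * Real.exp (l ^ 2 * (K * a) ^ 2 / 2) := by
    intro e w l hl
    -- The nets must approximate on the sample and on its ghost copy at once, hence `2n` points.
    set x : Fin (n + n) → 𝒳 := Fin.append (fun i => (w i).1.1) (fun i => (w i).2.1) with hx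
    have hxs : ∀ f g : 𝒳 → ℝ, ∑ i, (f (x i) - g (x i)) ^ 2 =
        ∑ i, ((f (w i).1.1 - g (w i).1.1) ^ 2 + (f (w i).2.1 - g (w i).2.1) ^ 2) := by
      intro f g
      rw [Fin.sum_univ_add, Finset.sum_add_distrib]
      simp only [hx, Fin.append_left, Fin.append_right]
    have hnets := fun k : ℕ => exists_net (H := H) (ε := D * (1 / 2) ^ k) (by positivity)
      (hcov (D * (1 / 2) ^ k) (by positivity)).1 (N := n + n) (by omega) x
    choose π hπ1 hπ2 using hnets
    set π' : ℕ → (𝒳 → ℝ) → 𝒳 → ℝ := fun k => if k = 0 then fun _ => fstar else π k with hπ'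
    refine hchain (fun f => blockDiff (pairKernel h f) e w) π' F hF fstar hapos
      (fun f => by simp [hπ']) (fun k => ?_) (fun k f hf => ?_) l hl
    · by_cases hk : k = 0
      · subst hk
        simp only [hπ', if_true, Finset.image_const hF, Finset.card_singleton, Nat.cast_one]
        exact Real.one_le_exp (by positivity)
      · simp only [hπ', hk, if_false]
        refine le_trans (Nat.cast_le.2 (hπ2 k F hFH)) ((Real.le_exp_log _).trans ?_)
        exact Real.exp_le_exp.2 (hcov (D * (1 / 2) ^ k) (by positivity)).2
    · have h1 : ∑ i, ((f (w i).1.1 - π' k f (w i).1.1) ^ 2 +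
          (f (w i).2.1 - π' k f (w i).2.1) ^ 2) ≤ (n + n) * (2 * (D * (1 / 2) ^ k)) ^ 2 := by
        rw [← hxs]
        by_cases hk : k = 0
        · subst hk
          simp only [hπ', if_true]
          calc ∑ i, (f (x i) - fstar (x i)) ^ 2 ≤ ∑ _i : Fin (n + n), D ^ 2 := by
                refine Finset.sum_le_sum fun i _ => ?_
                rw [← sq_abs]
                exact pow_le_pow_left₀ (abs_nonneg _) (hfg f (hFH hf) _) 2
            _ = (n + n) * D ^ 2 := by simp
            _ ≤ _ := by
                gcongr
                simp; linarith
        · simp only [hπ', hk, if_false]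
          have := hπ1 k f (hFH hf)
          push_cast at this
          exact this
      refine (sum_sq_blockDiff_sub_le hh e w f (π' k f)).trans ?_
      calc 4 * ((m : ℝ)⁻¹ * (1 / h ^ 2)) ^ 2 * ∑ i, ((f (w i).1.1 - π' k f (w i).1.1) ^ 2 +
            (f (w i).2.1 - π' k f (w i).2.1) ^ 2)
          -- With `m⁻¹ ≤ 3 / n`, `2n` points and doubled radius, the constant is `4 · 9 · 8 = 288 ≤
          -- 18²`; this is the origin of `18` in `a`.
          ≤ 4 * ((3 / n) * (1 / h ^ 2)) ^ 2 * ((n + n) * (2 * (D * (1 / 2) ^ k)) ^ 2) := by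
            gcongr
            rw [inv_le_comm₀ hm0 (by positivity), inv_div]
            linarith
        _ = 288 / n * (1 / h ^ 2) ^ 2 * (D * (1 / 2) ^ k) ^ 2 := by
            field_simp; ring
        _ ≤ 324 / n * (1 / h ^ 2) ^ 2 * (D * (1 / 2) ^ k) ^ 2 := by gcongr; norm_num
        _ = (a * (D * (1 / 2) ^ k)) ^ 2 := by
            have hasq : a ^ 2 = 324 / ((h ^ 2) ^ 2 * n) := by
              rw [ha, div_pow, mul_pow, Real.sq_sqrt hn0.le]; norm_num
            rw [mul_pow a, hasq]
            field_simp
  set B : ℝ := K * a with hB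
  have hBpos : 0 < B := by positivity
  have hBeq : K * 18 / (h ^ 2 * Real.sqrt n) = B := by rw [hB, ha]; ring
  have hq : ∀ f : {f // f ∈ H}, Measurable (Function.uncurry (pairKernel h f.1)) := fun f => by
    have h1 := (hH.continuous f.1 f.2).measurable
    have h2 := (continuous_gaussKernel h).measurable
    have h3 := measurable_errorVar h1
    simp only [pairKernel, Function.uncurry_def]
    fun_prop
  have hF'ne : (F.subtype (· ∈ H)).Nonempty := by
    obtain ⟨f, hf⟩ := hF
    exact ⟨⟨f, hFH hf⟩, Finset.mem_subtype.2 hf⟩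
  have key := measure_pairMean_deviation_le ρ hF'ne hq
    (fun f z z' => abs_gaussKernel_le hh (errorVar f.1 z - errorVar f.1 z'))
    -- The parameter `t / B²` minimizes `l² B² / 2 - l t`.
    ⟨fstar, hH.fstar_mem⟩ hm e (l := t / B ^ 2) (by positivity)
    (b := 2 * Real.exp ((t / B ^ 2) ^ 2 * B ^ 2 / 2)) (fun e w => by
      refine (signMean_mono fun σ => ?_).trans (hchainF e w (t / B ^ 2) (by positivity))
      refine Finset.sup'_le _ _ fun f hf => ?_
      exact Finset.le_sup' (fun f => Real.exp (t / B ^ 2 * signedSum (fun k =>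
        blockDiff (pairKernel h f) e w k - blockDiff (pairKernel h fstar) e w k) σ))
        (Finset.mem_subtype.1 hf)) t
  have hfinal : 2 * Real.exp ((t / B ^ 2) ^ 2 * B ^ 2 / 2) * Real.exp (-(t / B ^ 2 * t)) =
      2 * Real.exp (-(t ^ 2 / (2 * (K * 18 / (h ^ 2 * Real.sqrt n)) ^ 2))) := by
    rw [mul_assoc, ← Real.exp_add, hBeq]
    congr 2
    field_simp; ring
  rw [hfinal] at key
  refine (measure_mono ?_).trans key
  rintro z ⟨f, hf, hft⟩
  exact ⟨⟨f, hFH hf⟩, Finset.mem_subtype.2 hf, hft⟩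

/-- Sub-Gaussian deviations of the U-statistics with Gaussian kernel, uniformly over the hypothesis
space. -/
theorem AdmissibleSpace.exists_deviation [TopologicalSpace.SeparableSpace 𝒳]
    {ρ : Measure (𝒳 × ℝ)} [IsProbabilityMeasure ρ]
    {fstar : 𝒳 → ℝ} {H : Set (𝒳 → ℝ)} (hH : AdmissibleSpace ρ fstar H) :
    ∃ K : ℝ, 0 < K ∧ ∀ (n : ℕ) (h t : ℝ), 2 ≤ n → 0 < h → 0 < t →
      sampleLaw ρ n {z | ∃ f ∈ H, t <
        (pairMean (pairKernel h f) z - pairMean (pairKernel h fstar) z) -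
          (kernelCorr ρ h f - kernelCorr ρ h fstar)} ≤
        ENNReal.ofReal (2 * Real.exp (-(t ^ 2 / (2 * (K / (h ^ 2 * Real.sqrt n)) ^ 2)))) := by
  classical
  obtain ⟨K, hK, hdev⟩ := hH.exists_finite_deviation
  refine ⟨K, hK, fun n h t hn hh ht => ?_⟩
  have : SecondCountableTopology 𝒳 := UniformSpace.secondCountable_of_separable 𝒳
  set S : {f // f ∈ H} → Set (Fin n → 𝒳 × ℝ) := fun f => {z | t <
        (pairMean (pairKernel h f.1) z - pairMean (pairKernel h fstar) z) -
          (kernelCorr ρ h f.1 - kernelCorr ρ h fstar)} with hS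
  have hcont : ∀ f ∈ H, Continuous fun z : Fin n → 𝒳 × ℝ => pairMean (pairKernel h f) z := by
    intro f hf
    have h1 := hH.continuous f hf
    have h2 := continuous_gaussKernel h
    simp only [pairMean, pairKernel, errorVar]
    fun_prop
  have hopen : ∀ f, IsOpen (S f) := fun f =>
    isOpen_lt continuous_const (((hcont f.1 f.2).sub (hcont fstar hH.fstar_mem)).sub
      continuous_const)
  -- The strict inequality and continuity in `z` make each event open, so a countable subfamily
  -- already has the same union.
  obtain ⟨T, hT, hTU⟩ := TopologicalSpace.isOpen_iUnion_countable S hopen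
  obtain ⟨u, hu⟩ := (hT.insert ⟨fstar, hH.fstar_mem⟩).exists_eq_range (Set.insert_nonempty _ _)
  have hsub : {z | ∃ f ∈ H, t < (pairMean (pairKernel h f) z - pairMean (pairKernel h fstar) z) -
      (kernelCorr ρ h f - kernelCorr ρ h fstar)} ⊆ ⋃ k, S (u k) := by
    rintro z ⟨f, hf, hz⟩
    have h1 : z ∈ ⋃ i ∈ T, S i := by
      rw [hTU]; exact Set.mem_iUnion.2 ⟨⟨f, hf⟩, hz⟩
    simp only [Set.mem_iUnion, exists_prop] at h1
    obtain ⟨g, hg, hz'⟩ := h1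
    have h2 : g ∈ Set.range u := hu ▸ Set.mem_insert_of_mem _ hg
    obtain ⟨k, rfl⟩ := h2
    exact Set.mem_iUnion.2 ⟨k, hz'⟩
  refine (measure_mono hsub).trans ?_
  -- Continuity from below: the finite bound does not depend on the number of functions, so it
  -- passes to the countable union.
  rw [measure_iUnion_eq_iSup_accumulate]
  refine iSup_le fun k => ?_
  refine (measure_mono ?_).trans (hdev n h t hn hh ht ((Finset.range (k + 1)).image
    fun j => (u j).1) (by simp) (fun f hf => ?_))
  · intro z hz
    obtain ⟨j, hj, hzj⟩ := Set.mem_accumulate.1 hz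
    exact ⟨(u j).1, Finset.mem_image_of_mem _ (Finset.mem_range.2 (by omega)), hzj⟩
  · simp only [Finset.coe_image, Set.mem_image] at hf
    obtain ⟨j, _, rfl⟩ := hf
    exact (u j).2

end Deviation

/-! ### From empirical entropy to the U-statistic. -/

section Minimizer

variable {𝒳 : Type*}

/-- The diagonal of the double sum is `n` times the kernel at `0`, whatever the function, so
comparing entropies amounts to comparing off-diagonal sums. -/
lemma pairMean_le_of_empiricalEntropy_le {n : ℕ} (hn : 2 ≤ n) {h : ℝ} (hh : 0 < h)
    {z : Fin n → 𝒳 × ℝ} {f g : 𝒳 → ℝ}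
    (hfg : empiricalEntropy h z f ≤ empiricalEntropy h z g) :
    pairMean (pairKernel h g) z ≤ pairMean (pairKernel h f) z := by
  have hn0 : (0 : ℝ) < n := by exact_mod_cast (by omega : 0 < n)
  have : Nonempty (Fin n) := ⟨⟨0, by omega⟩⟩
  have h1 : ∀ f : 𝒳 → ℝ, (1 / (n : ℝ)) * ∑ i, empiricalDensity h z f (errorVar f (z i)) =
      (1 / (n : ℝ)) ^ 2 * (n * gaussKernel h 0 +
        ∑ ij ∈ (Finset.univ : Finset (Fin n)).offDiag, pairKernel h f (z ij.1) (z ij.2)) := by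
    intro f
    have h2 : ∑ i, ∑ j, pairKernel h f (z i) (z j) = n * gaussKernel h 0 +
        ∑ ij ∈ (Finset.univ : Finset (Fin n)).offDiag, pairKernel h f (z ij.1) (z ij.2) := by
      rw [← Finset.sum_product', ← Finset.diag_union_offDiag,
        Finset.sum_union (Finset.disjoint_diag_offDiag _), Finset.sum_diag]
      simp [pairKernel]
    rw [← h2]
    simp only [empiricalDensity, pairKernel, ← Finset.mul_sum]
    ring
  have hpos : ∀ f : 𝒳 → ℝ, 0 < (1 / (n : ℝ)) * ∑ i, empiricalDensity h z f (errorVar f (z i)) := by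
    intro f
    refine mul_pos (by positivity) (Finset.sum_pos (fun i _ => ?_) Finset.univ_nonempty)
    exact mul_pos (by positivity)
      (Finset.sum_pos (fun j _ => gaussKernel_pos hh _) Finset.univ_nonempty)
  have h3 := (Real.log_le_log_iff (hpos g) (hpos f)).1 (neg_le_neg_iff.1 hfg)
  rw [h1, h1] at h3
  have h4 := le_of_mul_le_mul_left h3 (by positivity)
  rw [pairMean, pairMean]
  refine mul_le_mul_of_nonneg_left (by linarith) (inv_nonneg.2 ?_)
  have : (2 : ℝ) ≤ n := by exact_mod_cast hn
  nlinarith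

end Minimizer

lemma adjustedSqDist_le_of_bounded {𝒳 : Type*} [MeasurableSpace 𝒳] {ρ : Measure (𝒳 × ℝ)} [IsProbabilityMeasure ρ]
    {fstar f : 𝒳 → ℝ} {M : ℝ} (hs : ∀ x, |fstar x| ≤ M) (hf : ∀ x, |f x| ≤ M) :
    adjustedSqDist ρ fstar f ≤ (4 * M) ^ 2 := by
  have h1 : ∀ x, |fstar x - f x| ≤ 2 * M := fun x => by
    refine (abs_sub _ _).trans ?_
    linarith [hs x, hf x]
  have h2 : |∫ u, (fstar u - f u) ∂ρ.fst| ≤ 2 * M := abs_integral_le_of_abs_le h1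
  refine (le_abs_self _).trans (abs_integral_le_of_abs_le fun x => ?_)
  rw [abs_pow]
  refine pow_le_pow_left₀ (abs_nonneg _) ?_ 2
  rw [show f x + (∫ u, (fstar u - f u) ∂ρ.fst) - fstar x =
    (∫ u, (fstar u - f u) ∂ρ.fst) - (fstar x - f x) by ring]
  refine (abs_sub _ _).trans ?_
  linarith [h1 x]

/-! ### Consistency and learning rate. -/

section Learning

variable {𝒳 : Type*} [MetricSpace 𝒳] [MeasurableSpace 𝒳] [BorelSpace 𝒳]

/-- Learning rate of the algorithm for bounded bandwidths. -/
theorem IsNoiseLaw.exists_learning_rate [TopologicalSpace.SeparableSpace 𝒳]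
    {ρ : Measure (𝒳 × ℝ)} [IsProbabilityMeasure ρ] {fstar : 𝒳 → ℝ} {p : ℝ → ℝ} {B : ℝ}
    (hN : IsNoiseLaw ρ fstar p B) {H : Set (𝒳 → ℝ)} (hH : AdmissibleSpace ρ fstar H)
    {h₀ : ℝ} (hh₀ : 0 < h₀) :
    ∃ C : ℝ, 0 < C ∧ ∀ (h : ℕ → ℝ) (fz : (n : ℕ) → (Fin n → 𝒳 × ℝ) → 𝒳 → ℝ),
      IsMEEAlgorithm ρ H h fz → ∀ (n : ℕ) (δ : ℝ), 2 ≤ n → 0 < h n → h n ≤ h₀ → 0 < δ → δ < 1 →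
        sampleLaw ρ n {z | C * Real.sqrt (Real.log (2 / δ)) / (h n ^ 2 * Real.sqrt n) <
          adjustedSqDist ρ fstar (fz n z)} ≤ ENNReal.ofReal δ := by
  obtain ⟨M, hM⟩ := hH.bounded
  obtain ⟨C₁, hC₁, hadj⟩ := hN.exists_adjustedSqDist_le_kernelCorr
    (hM fstar hH.fstar_mem) M hh₀
  obtain ⟨K, hK, hdev⟩ := hH.exists_deviation
  refine ⟨C₁ * (K * Real.sqrt 2), by positivity, fun h fz hfz n δ hn hh hhh hδ hδ1 => ?_⟩
  have hn0 : (0 : ℝ) < n := by exact_mod_cast (by omega : 0 < n)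
  set L := Real.log (2 / δ) with hL
  have hLpos : 0 < L := Real.log_pos (by rw [lt_div_iff₀ hδ]; linarith)
  set b : ℝ := K / (h n ^ 2 * Real.sqrt n) with hb
  have hbpos : 0 < b := by positivity
  -- Chosen so that the sub-Gaussian tail equals `δ`.
  set t : ℝ := b * Real.sqrt (2 * L) with ht
  have htpos : 0 < t := by positivity
  have hd := hdev n (h n) t hn hh htpos
  have hδeq : 2 * Real.exp (-(t ^ 2 / (2 * b ^ 2))) = δ := by
    have h1 : t ^ 2 / (2 * b ^ 2) = L := by
      rw [ht, mul_pow, Real.sq_sqrt (by positivity)]; field_simp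
    rw [h1, hL, ← Real.log_inv, Real.exp_log (by positivity)]
    field_simp
  rw [hδeq] at hd
  -- Only monotonicity of the outer measure is used, so the selection of the minimizer may be
  -- nonmeasurable.
  refine (measure_mono_ae ?_).trans hd
  filter_upwards [hfz n (by omega)] with z hz hlt
  obtain ⟨hzH, hzmin⟩ := hz
  refine ⟨fz n z, hzH, ?_⟩
  have h2 := pairMean_le_of_empiricalEntropy_le hn hh (hzmin fstar hH.fstar_mem)
  have h3 := hadj (h n) (fz n z) hh hhh (hH.continuous _ hzH).measurable (hM _ hzH)
  have h4 : C₁ * (K * Real.sqrt 2) * Real.sqrt L / (h n ^ 2 * Real.sqrt n) = C₁ * t := by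
    rw [ht, hb, Real.sqrt_mul (by norm_num)]; ring
  have h5 : C₁ * t < C₁ * (kernelCorr ρ (h n) fstar - kernelCorr ρ (h n) (fz n z)) := by
    rw [← h4]; exact lt_of_lt_of_le hlt h3
  have h6 := lt_of_mul_lt_mul_left h5 hC₁.le
  linarith

/-- Consistency of the algorithm. -/
theorem IsNoiseLaw.tendsto_measure_adjustedSqDist [TopologicalSpace.SeparableSpace 𝒳]
    {ρ : Measure (𝒳 × ℝ)} [IsProbabilityMeasure ρ] {fstar : 𝒳 → ℝ} {p : ℝ → ℝ} {B : ℝ}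
    (hN : IsNoiseLaw ρ fstar p B) {H : Set (𝒳 → ℝ)} (hH : AdmissibleSpace ρ fstar H)
    {h : ℕ → ℝ} {fz : (n : ℕ) → (Fin n → 𝒳 × ℝ) → 𝒳 → ℝ} (hpos : ∀ n : ℕ, 1 ≤ n → 0 < h n)
    (h0 : Tendsto h atTop (𝓝 0))
    (hinf : Tendsto (fun n : ℕ => h n ^ 2 * Real.sqrt (n : ℝ)) atTop atTop)
    (hfz : IsMEEAlgorithm ρ H h fz) {ε : ℝ} (hε : 0 < ε) :
    Tendsto (fun n : ℕ => sampleLaw ρ n {z | ε < adjustedSqDist ρ fstar (fz n z)})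
      atTop (𝓝 0) := by
  obtain ⟨C, hC, hrate⟩ := hN.exists_learning_rate hH one_pos
  rw [ENNReal.tendsto_nhds_zero]
  intro η hη
  -- Truncation at `1` handles `η = ⊤` and, after halving, gives a confidence level below one.
  have hη' : (min η 1) ≠ ⊤ := ne_top_of_le_ne_top ENNReal.one_ne_top (min_le_right _ _)
  have hη1 : (min η 1).toReal ≤ 1 := by
    simpa using ENNReal.toReal_mono ENNReal.one_ne_top (min_le_right η 1)
  set δ : ℝ := (min η 1).toReal / 2 with hδ
  have hδpos : 0 < δ := half_pos (ENNReal.toReal_pos (lt_min hη one_pos).ne' hη')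
  have hδη : ENNReal.ofReal δ ≤ η := by
    refine le_trans ?_ (min_le_left η 1)
    rw [← ENNReal.ofReal_toReal hη']
    exact ENNReal.ofReal_le_ofReal (by linarith)
  filter_upwards [h0.eventually_le_const one_pos, eventually_ge_atTop 2,
    hinf.eventually_ge_atTop (C * Real.sqrt (Real.log (2 / δ)) / ε)] with n hn1 hn2 hn3
  have hh := hpos n (by omega)
  refine (measure_mono fun z hz => ?_).trans
    ((hrate h fz hfz n δ hn2 hh hn1 hδpos (by linarith)).trans hδη)
  have hz' : ε < adjustedSqDist ρ fstar (fz n z) := hz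
  refine lt_of_le_of_lt ?_ hz'
  have hn0 : (0 : ℝ) < n := by exact_mod_cast (by omega : 0 < n)
  rw [div_le_iff₀ hε] at hn3
  rw [div_le_iff₀ (by positivity)]
  linarith

/-- The learning rate for bandwidths of order `n ^ (-1 / 6)`. -/
theorem IsNoiseLaw.exists_rate_one_sixth [TopologicalSpace.SeparableSpace 𝒳]
    {ρ : Measure (𝒳 × ℝ)} [IsProbabilityMeasure ρ] {fstar : 𝒳 → ℝ} {p : ℝ → ℝ} {B : ℝ}
    (hN : IsNoiseLaw ρ fstar p B) {H : Set (𝒳 → ℝ)} (hH : AdmissibleSpace ρ fstar H)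
    {c₁ c₂ : ℝ} (hc₁ : 0 < c₁) (hc₂ : 0 < c₂) :
    ∃ C : ℝ, 0 < C ∧ ∀ (h : ℕ → ℝ) (fz : (n : ℕ) → (Fin n → 𝒳 × ℝ) → 𝒳 → ℝ),
      (∀ n : ℕ, 1 ≤ n → c₁ * (n : ℝ) ^ (-(1 / 6 : ℝ)) ≤ h n ∧
        h n ≤ c₂ * (n : ℝ) ^ (-(1 / 6 : ℝ))) →
      IsMEEAlgorithm ρ H h fz →
      ∀ δ : ℝ, 0 < δ → δ < 1 → ∀ n : ℕ, 1 ≤ n →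
        sampleLaw ρ n
          {z | C * Real.sqrt (Real.log (2 / δ)) * (n : ℝ) ^ (-(1 / 6 : ℝ)) <
            adjustedSqDist ρ fstar (fz n z)} ≤ ENNReal.ofReal δ := by
  obtain ⟨M, hM⟩ := hH.bounded
  obtain ⟨C, hC, hrate⟩ := hN.exists_learning_rate hH hc₂
  -- The second summand is for `n = 1`, where no pair of observations exists: `√(log (2/δ)) ≥ 1/2`
  -- makes the claim weaker than the trivial bound `(4M)²`.
  refine ⟨C / c₁ ^ 2 + 2 * (4 * M) ^ 2, by positivity, fun h fz hh hfz δ hδ hδ1 n hn => ?_⟩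
  set L := Real.log (2 / δ) with hL
  rcases hn.eq_or_lt with rfl | hn2
  · have h1 : sampleLaw ρ 1 {z | (C / c₁ ^ 2 + 2 * (4 * M) ^ 2) * Real.sqrt L *
        ((1 : ℕ) : ℝ) ^ (-(1 / 6 : ℝ)) < adjustedSqDist ρ fstar (fz 1 z)} ≤
        sampleLaw ρ 1 ∅ := by
      refine measure_mono_ae ?_
      filter_upwards [hfz 1 le_rfl] with z hz hlt
      have h2 : adjustedSqDist ρ fstar (fz 1 z) ≤ (4 * M) ^ 2 :=
        adjustedSqDist_le_of_bounded (hM fstar hH.fstar_mem) (hM _ hz.1)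
      have h3 : 1 / 2 ≤ Real.sqrt L := by
        refine Real.le_sqrt_of_sq_le ?_
        have h4 : Real.log 2 ≤ L := Real.log_le_log (by norm_num)
          (by rw [le_div_iff₀ hδ]; linarith)
        have := Real.log_two_gt_d9
        linarith
      have h5 : (C / c₁ ^ 2 + 2 * (4 * M) ^ 2) * Real.sqrt L < (4 * M) ^ 2 := by
        have : (C / c₁ ^ 2 + 2 * (4 * M) ^ 2) * Real.sqrt L * ((1 : ℕ) : ℝ) ^ (-(1 / 6 : ℝ)) <
          (4 * M) ^ 2 := lt_of_lt_of_le hlt h2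
        simpa using this
      have h6 : 0 < C / c₁ ^ 2 := by positivity
      exfalso
      nlinarith [sq_nonneg (4 * M)]
    exact h1.trans (by simp)
  · have hn0 : (0 : ℝ) < n := by exact_mod_cast hn
    set r : ℝ := (n : ℝ) ^ (1 / 6 : ℝ) with hr
    have hrpos : 0 < r := Real.rpow_pos_of_pos hn0 _
    have hr1 : 1 ≤ r := Real.one_le_rpow (by exact_mod_cast hn) (by norm_num)
    have hneg : (n : ℝ) ^ (-(1 / 6 : ℝ)) = r⁻¹ := Real.rpow_neg hn0.le _
    have hsq : Real.sqrt n = r ^ 3 := by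
      rw [hr, ← Real.rpow_natCast, ← Real.rpow_mul hn0.le, Real.sqrt_eq_rpow]
      norm_num
    obtain ⟨hl, hu⟩ := hh n hn
    rw [hneg] at hl hu ⊢
    have hhpos : 0 < h n := lt_of_lt_of_le (by positivity) hl
    have hle : h n ≤ c₂ := hu.trans (mul_le_of_le_one_right hc₂.le (inv_le_one_of_one_le₀ hr1))
    refine (measure_mono fun z hz => ?_).trans (hrate h fz hfz n δ hn2 hhpos hle hδ hδ1)
    have hz' : (C / c₁ ^ 2 + 2 * (4 * M) ^ 2) * Real.sqrt L * r⁻¹ <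
      adjustedSqDist ρ fstar (fz n z) := hz
    refine lt_of_le_of_lt ?_ hz'
    -- In terms of `r = n^(1/6)`, `h²` is at least `c₁² r⁻²` and `√n` is `r³`, so the deviation
    -- scale is of order `r⁻¹`.
    have h7 : c₁ ^ 2 * r ≤ h n ^ 2 * Real.sqrt n := by
      rw [hsq]
      calc c₁ ^ 2 * r = (c₁ * r⁻¹) ^ 2 * r ^ 3 := by field_simp
        _ ≤ _ := by gcongr
    calc C * Real.sqrt L / (h n ^ 2 * Real.sqrt n) ≤ C * Real.sqrt L / (c₁ ^ 2 * r) := by gcongr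
      _ = C / c₁ ^ 2 * Real.sqrt L * r⁻¹ := by field_simp
      _ ≤ _ := by
          gcongr
          have := sq_nonneg (4 * M)
          linarith

end Learning

end MEE

end

theorem mainTheorem2 {𝒳 : Type*} [MetricSpace 𝒳] [MeasurableSpace 𝒳] [BorelSpace 𝒳]
    (ρ : Measure (𝒳 × ℝ)) [IsProbabilityMeasure ρ] (fstar : 𝒳 → ℝ)
    (hmodel : MEE.AdmissibleModel ρ fstar) (hhomo : MEE.Homoskedastic ρ fstar) :
    -- (i)
    (MEE.minEntropy ρ = MEE.errorEntropy ρ fstar ∧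
      ∀ b : ℝ, MEE.IsEntropyMinimizer ρ (fun x => fstar x + b)) ∧
    -- (ii)
    (∀ M : ℝ, ∃ C : ℝ, 0 < C ∧ ∀ f : 𝒳 → ℝ, Measurable f → (∀ x, |f x| ≤ M) →
      MEE.adjustedSqDist ρ fstar f ≤ C * (MEE.errorEntropy ρ f - MEE.minEntropy ρ)) ∧
    -- (iii) and (iv)
    (TopologicalSpace.SeparableSpace 𝒳 →
      ∀ H : Set (𝒳 → ℝ), MEE.AdmissibleSpace ρ fstar H →
      (∀ (h : ℕ → ℝ) (fz : (n : ℕ) → (Fin n → 𝒳 × ℝ) → 𝒳 → ℝ),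
        (∀ n : ℕ, 1 ≤ n → 0 < h n) →
        Tendsto h atTop (𝓝 0) →
        Tendsto (fun n : ℕ => h n ^ 2 * Real.sqrt (n : ℝ)) atTop atTop →
        MEE.IsMEEAlgorithm ρ H h fz →
        ∀ ε : ℝ, 0 < ε →
          Tendsto
            (fun n : ℕ => MEE.sampleLaw ρ n {z | ε < MEE.adjustedSqDist ρ fstar (fz n z)})
            atTop (𝓝 0)) ∧
      (∀ (p : 𝒳 → ℝ → ℝ) (M' : ℝ), MEE.IsNoiseDensity ρ fstar p →
        (∀ x, Differentiable ℝ (p x)) → (∀ x t, |deriv (p x) t| ≤ M') →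
        ∀ c₁ c₂ : ℝ, 0 < c₁ → c₁ ≤ c₂ →
        ∃ C : ℝ, 0 < C ∧ ∀ (h : ℕ → ℝ) (fz : (n : ℕ) → (Fin n → 𝒳 × ℝ) → 𝒳 → ℝ),
          (∀ n : ℕ, 1 ≤ n → c₁ * (n : ℝ) ^ (-(1 / 6 : ℝ)) ≤ h n ∧
            h n ≤ c₂ * (n : ℝ) ^ (-(1 / 6 : ℝ))) →
          MEE.IsMEEAlgorithm ρ H h fz →
          ∀ δ : ℝ, 0 < δ → δ < 1 → ∀ n : ℕ, 1 ≤ n →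
            MEE.sampleLaw ρ n
              {z | C * Real.sqrt (Real.log (2 / δ)) * (n : ℝ) ^ (-(1 / 6 : ℝ)) <
                MEE.adjustedSqDist ρ fstar (fz n z)} ≤ ENNReal.ofReal δ)) := by

  obtain ⟨p, B, hN⟩ := hmodel.exists_noiseLaw hhomo
  obtain ⟨M₀, -, hM₀⟩ := hmodel.bounded
  refine ⟨⟨hN.minEntropy_eq, hN.isEntropyMinimizer⟩, hN.exists_adjustedSqDist_le hM₀,
    fun hsep H hH => ⟨?_, ?_⟩⟩
  · intro h fz hpos h0 hinf hfz ε hε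
    exact hN.tendsto_measure_adjustedSqDist hH hpos h0 hinf hfz hε
  · intro _ _ _ _ _ c₁ c₂ hc₁ hc₁₂
    exact hN.exists_rate_one_sixth hH hc₁ (hc₁.trans_le hc₁₂)
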